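/- Let $(U_1,g_1)$ and $(U_2,g_2)$ be oriented spherical surfaces, that is, oriented smooth surfaces with smooth Riemannian metrics of constant Gaussian curvature $+1$, with area forms $dA_{g_1}$ and $dA_{g_2}$. Let $\varphi:U_1\to U_2$ be an orientation-preserving diffeomorphism, and let $b$ be the unique positive definite, $g_1$-self-adjoint smooth $(1,1)$ tensor on $U_1$ such that $\varphi^*g_2=g_1(b\,\cdot,b\,\cdot)$. Endow $U_1\times U_2$ with the Riemannian metric $g_1\oplus g_2$ and with the symplectic form $\pi_1^*dA_{g_1}-\pi_2^*dA_{g_2}$, where $\pi_i:U_1\times U_2\to U_i$ are the projections. Then the graph $\{(x,\varphi(x)) : x\in U_1\}$ is a minimal Lagrangian submanifold of $U_1\times U_2$ (its mean curvature vector vanishes, and the symplectic form vanishes on it) if and only if $$d^{\nabla}b=0\qquad\text{and}\qquad \det b=1,$$ where $\nabla$ is the Levi-Civita connection of $g_1$ and $d^{\nabla}b(v,w)=\nabla_v(b(w))-\nabla_w(b(v))-b([v,w])$ for vector fields $v,w$ on $U_1$. -/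

import Mathlib

open Bundle FiberBundle VectorField
open scoped Manifold ContDiff Topology

noncomputable section

namespace MinLag

section LC
variable {E : Type*} [NormedAddCommGroup E] [NormedSpace ℝ E]
  {H : Type*} [TopologicalSpace H] {I : ModelWithCorners ℝ E H}
  {M : Type*} [TopologicalSpace M] [ChartedSpace H M]

theorem finiteDimensional_tangentSpace [FiniteDimensional ℝ E] (x : M) :
    FiniteDimensional ℝ (TangentSpace I x) :=
  inferInstanceAs (FiniteDimensional ℝ E)

theorem t2Space_tangentSpace (x : M) : T2Space (TangentSpace I x) :=
  inferInstanceAs (T2Space E)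

variable [IsManifold I ∞ M]

variable (I M) in
/-- Smooth Riemannian metrics on `M`. -/
abbrev SmoothMetric : Type _ := ContMDiffRiemannianMetric I ∞ E (fun x : M ↦ TangentSpace I x)

/-- The function `y ↦ g(X, Y)(y)`. -/
def SmoothMetric.pair (g : SmoothMetric I M) (X Y : Π x : M, TangentSpace I x) : M → ℝ :=
  fun y ↦ g.inner y (X y) (Y y)

theorem SmoothMetric.mdifferentiableAt_pair (g : SmoothMetric I M) {X Y : Π x : M, TangentSpace I x} {x : M}
    (hX : MDiffAt (T% X) x) (hY : MDiffAt (T% Y) x) : MDiffAt (g.pair X Y) x := by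
  let : RiemannianBundle (fun x : M ↦ TangentSpace I x) := ⟨g.toRiemannianMetric⟩
  have : IsContMDiffRiemannianBundle I 1 E (fun x : M ↦ TangentSpace I x) := inferInstance
  exact MDifferentiableAt.inner_bundle (IB := I) (F := E) (E := fun x : M ↦ TangentSpace I x) (b := id) hX hY

/-- The Koszul expression, equal to `g(∇_X Y, Z)` at `x` for the Levi-Civita connection. -/
def koszul (g : SmoothMetric I M) (Y X Z : Π x : M, TangentSpace I x) (x : M) : ℝ :=
  2⁻¹ * (mvfderiv I (g.pair Y Z) x (X x) + mvfderiv I (g.pair X Z) x (Y x)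
    - mvfderiv I (g.pair X Y) x (Z x)
    + g.inner x (mlieBracket I X Y x) (Z x) - g.inner x (mlieBracket I X Z x) (Y x)
    - g.inner x (mlieBracket I Y Z x) (X x))

theorem SmoothMetric.pair_smul_left (g : SmoothMetric I M) (f : M → ℝ) (X Y : Π x : M, TangentSpace I x) :
    g.pair (f • X) Y = f * g.pair X Y := by
  ext y; simp [SmoothMetric.pair]
theorem SmoothMetric.pair_smul_right (g : SmoothMetric I M) (f : M → ℝ) (X Y : Π x : M, TangentSpace I x) :
    g.pair X (f • Y) = f * g.pair X Y := by
  ext y; simp [SmoothMetric.pair]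
theorem SmoothMetric.pair_add_left (g : SmoothMetric I M) (X X' Y : Π x : M, TangentSpace I x) :
    g.pair (X + X') Y = g.pair X Y + g.pair X' Y := by
  ext y; simp [SmoothMetric.pair]
theorem SmoothMetric.pair_add_right (g : SmoothMetric I M) (X Y Y' : Π x : M, TangentSpace I x) :
    g.pair X (Y + Y') = g.pair X Y + g.pair X Y' := by
  ext y; simp [SmoothMetric.pair]
theorem SmoothMetric.pair_symm (g : SmoothMetric I M) (X Y : Π x : M, TangentSpace I x) :
    g.pair X Y = g.pair Y X := by
  ext y; exact g.symm _ _ _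

variable [FiniteDimensional ℝ E]

theorem koszul_tensorial₁ (g : SmoothMetric I M) {Y Z : Π x : M, TangentSpace I x} {x : M}
    (hY : MDiffAt (T% Y) x) (hZ : MDiffAt (T% Z) x) :
    TensorialAt I E (koszul g Y · Z x) x where
  smul {f X} hf hX := by
    simp only [koszul, SmoothMetric.pair_smul_left, mvfderiv_mul hf (g.mdifferentiableAt_pair hX hZ),
      mvfderiv_mul hf (g.mdifferentiableAt_pair hX hY), mlieBracket_smul_left hf hX]
    simp [SmoothMetric.pair]
    ring
  add {X X'} hX hX' := by
    simp only [koszul, SmoothMetric.pair_add_left, mvfderiv_add (g.mdifferentiableAt_pair hX hZ) (g.mdifferentiableAt_pair hX' hZ),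
      mvfderiv_add (g.mdifferentiableAt_pair hX hY) (g.mdifferentiableAt_pair hX' hY), mlieBracket_add_left hX hX']
    simp
    ring

theorem koszul_tensorial₂ (g : SmoothMetric I M) {Y X : Π x : M, TangentSpace I x} {x : M}
    (hY : MDiffAt (T% Y) x) (hX : MDiffAt (T% X) x) :
    TensorialAt I E (koszul g Y X · x) x where
  smul {f Z} hf hZ := by
    simp only [koszul, SmoothMetric.pair_smul_right, mvfderiv_mul hf (g.mdifferentiableAt_pair hX hZ),
      mvfderiv_mul hf (g.mdifferentiableAt_pair hY hZ), mlieBracket_smul_right hf hZ]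
    simp [SmoothMetric.pair, g.symm x (Z x) (X x), g.symm x (Z x) (Y x)]
    ring
  add {Z Z'} hZ hZ' := by
    simp only [koszul, SmoothMetric.pair_add_right, mvfderiv_add (g.mdifferentiableAt_pair hX hZ) (g.mdifferentiableAt_pair hX hZ'),
      mvfderiv_add (g.mdifferentiableAt_pair hY hZ) (g.mdifferentiableAt_pair hY hZ'), mlieBracket_add_right hZ hZ']
    simp
    ring

theorem koszul_add (g : SmoothMetric I M) {Y Y' X Z : Π x : M, TangentSpace I x} {x : M}
    (hY : MDiffAt (T% Y) x) (hY' : MDiffAt (T% Y') x) (hX : MDiffAt (T% X) x) (hZ : MDiffAt (T% Z) x) :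
    koszul g (Y + Y') X Z x = koszul g Y X Z x + koszul g Y' X Z x := by
  simp only [koszul, SmoothMetric.pair_add_left, SmoothMetric.pair_add_right, 
    mvfderiv_add (g.mdifferentiableAt_pair hX hY) (g.mdifferentiableAt_pair hX hY'),
    mvfderiv_add (g.mdifferentiableAt_pair hY hZ) (g.mdifferentiableAt_pair hY' hZ), 
    mlieBracket_add_right hY hY', mlieBracket_add_left hY hY']
  simp
  ring

theorem koszul_leibniz (g : SmoothMetric I M) {Y X Z : Π x : M, TangentSpace I x} {f : M → ℝ} {x : M}
    (hf : MDiffAt f x)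
    (hY : MDiffAt (T% Y) x) (hX : MDiffAt (T% X) x) (hZ : MDiffAt (T% Z) x) :
    koszul g (f • Y) X Z x = f x * koszul g Y X Z x 
      + mvfderiv I f x (X x) * g.inner x (Y x) (Z x) := by
  simp only [koszul, SmoothMetric.pair_smul_left, SmoothMetric.pair_smul_right, 
    mvfderiv_mul hf (g.mdifferentiableAt_pair hX hY),
    mvfderiv_mul hf (g.mdifferentiableAt_pair hY hZ), 
    mlieBracket_smul_right hf hY, mlieBracket_smul_left hf hY]
  simp [SmoothMetric.pair, g.symm x (Y x) (X x)]
  ring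

/-- The musical isomorphism `v ↦ g(v, ·)`. -/
def SmoothMetric.flat (g : SmoothMetric I M) (x : M) :
    TangentSpace I x ≃ₗ[ℝ] (TangentSpace I x →L[ℝ] ℝ) :=
  haveI := finiteDimensional_tangentSpace (I := I) x
  haveI := t2Space_tangentSpace (I := I) x
  haveI : FiniteDimensional ℝ (TangentSpace I x →L[ℝ] ℝ) :=
    LinearEquiv.finiteDimensional
      (LinearMap.toContinuousLinearMap (𝕜 := ℝ) (E := TangentSpace I x) (F' := ℝ))
  LinearMap.linearEquivOfInjective (g.inner x : TangentSpace I x →ₗ[ℝ] (TangentSpace I x →L[ℝ] ℝ))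
    (by
      rw [← LinearMap.ker_eq_bot, LinearMap.ker_eq_bot']
      intro v hv
      by_contra hne
      have h1 := g.pos x v hne
      have h2 : g.inner x v v = 0 := by
        have := congrArg (fun L : TangentSpace I x →L[ℝ] ℝ ↦ L v) hv
        simpa using this
      exact h1.ne' h2)
    (by
      rw [← LinearEquiv.finrank_eq
        (LinearMap.toContinuousLinearMap (𝕜 := ℝ) (E := TangentSpace I x) (F' := ℝ))]
      exact (Subspace.dual_finrank_eq (K := ℝ) (V := TangentSpace I x)).symm)

theorem SmoothMetric.inner_flat_symm (g : SmoothMetric I M) (x : M) (L : TangentSpace I x →L[ℝ] ℝ)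
    (w : TangentSpace I x) : g.inner x ((g.flat x).symm L) w = L w := by
  have : g.flat x ((g.flat x).symm L) = L := LinearEquiv.apply_symm_apply _ _
  exact congrArg (fun L : TangentSpace I x →L[ℝ] ℝ ↦ L w) this

theorem SmoothMetric.ext_inner (g : SmoothMetric I M) {x : M} {u v : TangentSpace I x}
    (h : ∀ w, g.inner x u w = g.inner x v w) : u = v :=
  (g.flat x).injective (ContinuousLinearMap.ext h)

open Classical in
/-- For `Y` differentiable at `x`, the map `v ↦ ∇_v Y` at `x`, where `g(∇_v Y, w)` is given by the
Koszul formula. -/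
def leviCivitaFun (g : SmoothMetric I M) (Y : Π x : M, TangentSpace I x) (x : M) :
    TangentSpace I x →L[ℝ] TangentSpace I x :=
  haveI := finiteDimensional_tangentSpace (I := I) x
  haveI := t2Space_tangentSpace (I := I) x
  if hY : MDiffAt (T% Y) x then
    LinearMap.toContinuousLinearMap ((g.flat x).symm.toLinearMap ∘ₗ
      (TensorialAt.mkHom₂ (F := E) (F' := E) (I := I) (koszul g Y · · x) x
        (fun _ hZ ↦ koszul_tensorial₁ g hY hZ) (fun _ hX ↦ koszul_tensorial₂ g hY hX) :
          TangentSpace I x →ₗ[ℝ] (TangentSpace I x →L[ℝ] ℝ)))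
  else 0

theorem inner_leviCivitaFun (g : SmoothMetric I M) {X Y Z : Π x : M, TangentSpace I x} {x : M}
    (hX : MDiffAt (T% X) x) (hY : MDiffAt (T% Y) x) (hZ : MDiffAt (T% Z) x) :
    g.inner x (leviCivitaFun g Y x (X x)) (Z x) = koszul g Y X Z x := by
  rw [leviCivitaFun, dif_pos hY]
  exact (g.inner_flat_symm x _ _).trans (TensorialAt.mkHom₂_apply
    (fun _ hZ ↦ koszul_tensorial₁ g hY hZ) (fun _ hX ↦ koszul_tensorial₂ g hY hX) hX hZ)

theorem leviCivitaFun_ext (g : SmoothMetric I M) {Y : Π x : M, TangentSpace I x} {x : M}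
    (hY : MDiffAt (T% Y) x) (L : TangentSpace I x →L[ℝ] TangentSpace I x)
    (h : ∀ X Z : Π x : M, TangentSpace I x, MDiffAt (T% X) x → MDiffAt (T% Z) x →
      koszul g Y X Z x = g.inner x (L (X x)) (Z x)) :
    leviCivitaFun g Y x = L := by
  ext v
  refine g.ext_inner fun w ↦ ?_
  have hv := mdifferentiableAt_extend I E v
  have hw := mdifferentiableAt_extend I E w
  have := (inner_leviCivitaFun g hv hY hw).trans (h _ _ hv hw)
  simpa using this

/-- The Levi-Civita connection of `g`; `leviCivita g Y x v` is `∇_v Y` at `x`. -/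
def leviCivita (g : SmoothMetric I M) : CovariantDerivative I E (TangentSpace I : M → Type _) where
  toFun := leviCivitaFun g
  isCovariantDerivativeOnUniv :=
    { add := by
        intro σ σ' x hσ hσ' _
        refine leviCivitaFun_ext g (mdifferentiableAt_add_section hσ hσ') _ fun X Z hX hZ ↦ ?_
        simp [koszul_add g hσ hσ' hX hZ, inner_leviCivitaFun g hX hσ hZ,
          inner_leviCivitaFun g hX hσ' hZ]
      leibniz := by
        intro σ f x hσ hf _
        refine leviCivitaFun_ext g (hf.smul_section hσ) _ fun X Z hX hZ ↦ ?_
        simp [koszul_leibniz g hf hσ hX hZ, inner_leviCivitaFun g hX hσ hZ] }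

theorem leviCivita_torsion_free (g : SmoothMetric I M) {X Y : Π x : M, TangentSpace I x} {x : M}
    (hX : MDiffAt (T% X) x) (hY : MDiffAt (T% Y) x) :
    leviCivita g Y x (X x) - leviCivita g X x (Y x) = mlieBracket I X Y x := by
  refine g.ext_inner fun w ↦ ?_
  have hw := mdifferentiableAt_extend I E w
  have h1 := inner_leviCivitaFun g hX hY hw
  have h2 := inner_leviCivitaFun g hY hX hw
  simp only [extend_apply_self] at h1 h2
  rw [map_sub]
  change g.inner x (leviCivitaFun g Y x (X x)) w - g.inner x (leviCivitaFun g X x (Y x)) w = _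
  rw [h1, h2, koszul, koszul, mlieBracket_swap_apply (V := Y) (W := X), SmoothMetric.pair_symm g Y X]
  simp
  ring

theorem leviCivita_metric (g : SmoothMetric I M) {X Y Z : Π x : M, TangentSpace I x} {x : M}
    (hX : MDiffAt (T% X) x) (hY : MDiffAt (T% Y) x) (hZ : MDiffAt (T% Z) x) :
    mvfderiv I (g.pair Y Z) x (X x) =
      g.inner x (leviCivita g Y x (X x)) (Z x) + g.inner x (Y x) (leviCivita g Z x (X x)) := by
  have h1 := inner_leviCivitaFun g hX hY hZ
  have h2 := inner_leviCivitaFun g hX hZ hY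
  rw [g.symm x (Y x)]
  change _ = g.inner x (leviCivitaFun g Y x (X x)) (Z x) + g.inner x (leviCivitaFun g Z x (X x)) (Y x)
  rw [h1, h2, koszul, koszul, mlieBracket_swap_apply (V := Z) (W := Y), SmoothMetric.pair_symm g Z Y]
  simp
  ring

/-- The curvature `R(X,Y)Z = ∇_X ∇_Y Z - ∇_Y ∇_X Z - ∇_{[X,Y]} Z` of the Levi-Civita connection. -/
def curvature (g : SmoothMetric I M) (X Y Z : Π x : M, TangentSpace I x) (x : M) :
    TangentSpace I x :=
  leviCivita g (fun y ↦ leviCivita g Z y (Y y)) x (X x)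
    - leviCivita g (fun y ↦ leviCivita g Z y (X y)) x (Y x)
    - leviCivita g Z x (mlieBracket I X Y x)

/-- All sectional curvatures of `g` are equal to `K`:
`g(R(X,Y)Y, X) = K (g(X,X) g(Y,Y) - g(X,Y)^2)` for all (germs of) smooth vector fields. -/
def HasConstantCurvature (g : SmoothMetric I M) (K : ℝ) : Prop :=
  ∀ (x : M) (X Y : Π x : M, TangentSpace I x),
    CMDiffAt ∞ (T% X) x → CMDiffAt ∞ (T% Y) x →
    g.inner x (curvature g X Y Y x) (X x) =
      K * (g.inner x (X x) (X x) * g.inner x (Y x) (Y x) - g.inner x (X x) (Y x) ^ 2)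

/-- The exterior derivative `d^∇A(X,Y) = ∇_X(A(Y)) - ∇_Y(A(X)) - A([X,Y])` of a `(1,1)` tensor `A`
for the Levi-Civita connection of `g`. -/
def extDerivTensor (g : SmoothMetric I M) (A : Π x : M, TangentSpace I x →L[ℝ] TangentSpace I x)
    (X Y : Π x : M, TangentSpace I x) (x : M) : TangentSpace I x :=
  leviCivita g (fun y ↦ A y (Y y)) x (X x) - leviCivita g (fun y ↦ A y (X y)) x (Y x)
    - A x (mlieBracket I X Y x)

/-- `d^∇A = 0`: the exterior derivative vanishes on all (germs of) smooth vector fields. -/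
def IsCodazzi (g : SmoothMetric I M) (A : Π x : M, TangentSpace I x →L[ℝ] TangentSpace I x) :
    Prop :=
  ∀ (x : M) (X Y : Π x : M, TangentSpace I x),
    CMDiffAt ∞ (T% X) x → CMDiffAt ∞ (T% Y) x → extDerivTensor g A X Y x = 0

/-- Smoothness of a `(1,1)` tensor, as a section of the endomorphism bundle of the tangent
bundle. -/
def IsSmoothEndo (A : Π x : M, TangentSpace I x →L[ℝ] TangentSpace I x) : Prop :=
  ContMDiff I (I.prod 𝓘(ℝ, E →L[ℝ] E)) ∞
    (fun x : M ↦ TotalSpace.mk' (E →L[ℝ] E)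
      (E := fun x : M ↦ TangentSpace I x →L[ℝ] TangentSpace I x) x (A x))

end LC

section Pullback
variable {E : Type*} [NormedAddCommGroup E] [NormedSpace ℝ E]
  {H : Type*} [TopologicalSpace H] {I : ModelWithCorners ℝ E H}
  {M : Type*} [TopologicalSpace M] [ChartedSpace H M]
  {E' : Type*} [NormedAddCommGroup E'] [NormedSpace ℝ E']
  {H' : Type*} [TopologicalSpace H'] {J : ModelWithCorners ℝ E' H'}
  {N : Type*} [TopologicalSpace N] [ChartedSpace H' N]

variable (I M) in
/-- Fields of bilinear forms on the tangent spaces of `M`. -/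
abbrev BilinField : Type _ := Π x : M, TangentSpace I x →L[ℝ] TangentSpace I x →L[ℝ] ℝ

/-- The pull-back `F^*B`. -/
def pullback (F : M → N) (B : BilinField J N) : BilinField I M :=
  fun x ↦ (ContinuousLinearMap.precomp ℝ (mfderiv I J F x)).comp
    ((B (F x)).comp (mfderiv I J F x))

theorem pullback_apply (F : M → N) (B : BilinField J N) (x : M) (u v : TangentSpace I x) :
    pullback (I := I) F B x u v = B (F x) (mfderiv I J F x u) (mfderiv I J F x v) := rfl

theorem contMDiffAt_clm_of_apply [FiniteDimensional ℝ E'] {G : Type*} [NormedAddCommGroup G] [NormedSpace ℝ G]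
    {f : M → E' →L[ℝ] G} {x : M}
    (h : ∀ e, ContMDiffAt I 𝓘(ℝ, G) ∞ (fun y ↦ f y e) x) :
    ContMDiffAt I 𝓘(ℝ, E' →L[ℝ] G) ∞ f x := by
  let b := Module.finBasis ℝ E'
  have hb : f = fun y ↦ ∑ i, (ContinuousLinearMap.smulRightL ℝ E' G (LinearMap.toContinuousLinearMap (b.coord i))) (f y (b i)) := by
    funext y
    ext v
    conv_lhs => rw [← b.sum_repr v, map_sum]
    simp
  rw [hb]
  refine ContMDiffAt.sum fun i _ ↦ ?_
  exact ContMDiffAt.clm_apply contMDiffAt_const (h (b i))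

variable (I M) in
/-- Smoothness of a field of bilinear forms. -/
def IsSmoothBilin [IsManifold I ∞ M] (B : BilinField I M) : Prop :=
  ContMDiff I (I.prod 𝓘(ℝ, E →L[ℝ] E →L[ℝ] ℝ)) ∞
    (fun x : M ↦ TotalSpace.mk' (E →L[ℝ] E →L[ℝ] ℝ)
      (E := fun x : M ↦ TangentSpace I x →L[ℝ] TangentSpace I x →L[ℝ] ℝ) x (B x))

theorem IsSmoothBilin.add [IsManifold I ∞ M] {B B' : BilinField I M}
    (hB : IsSmoothBilin I M B) (hB' : IsSmoothBilin I M B') : IsSmoothBilin I M (B + B') :=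
  ContMDiff.add_section hB hB'

theorem isSmoothBilin_pullback [FiniteDimensional ℝ E] [IsManifold I ∞ M] [IsManifold J ∞ N]
    {F : M → N} (hF : ContMDiff I J ∞ F) {B : BilinField J N} (hB : IsSmoothBilin J N B) :
    IsSmoothBilin I M (pullback F B) := by
  intro x
  rw [contMDiffAt_hom_bundle]
  refine ⟨contMDiffAt_id, ?_⟩
  refine contMDiffAt_clm_of_apply fun e ↦ contMDiffAt_clm_of_apply fun e' ↦ ?_
  let t := trivializationAt E (fun x : M ↦ TangentSpace I x) x
  have hx : x ∈ t.baseSet := mem_baseSet_trivializationAt E (fun x : M ↦ TangentSpace I x) x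
  have key : ∀ e : E, ContMDiffAt I (J.prod 𝓘(ℝ, E')) ∞
      (fun y ↦ TotalSpace.mk' E' (E := fun x : N ↦ TangentSpace J x) (F y)
        (mfderiv I J F y (t.symm y e))) x := by
    intro e
    have h1 : ContMDiffAt I (I.prod 𝓘(ℝ, E)) ∞
        (fun y ↦ TotalSpace.mk' E (E := fun x : M ↦ TangentSpace I x) y (t.symm y e)) x := by
      refine (t.contMDiffAt_iff (IB := I) (n := ∞)
        (f := fun y ↦ TotalSpace.mk' E (E := fun x : M ↦ TangentSpace I x) y (t.symm y e))
        (t.mem_source.2 hx)).2 ⟨contMDiffAt_id, ?_⟩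
      refine (contMDiffAt_const (c := e)).congr_of_eventuallyEq ?_
      filter_upwards [t.open_baseSet.mem_nhds hx] with y hy
      simp [t.apply_mk_symm hy]
    exact ((hF.contMDiff_tangentMap (m := ∞) (by simp)).contMDiffAt).comp x h1
  have h2 := ContMDiffAt.clm_bundle_apply₂ (F₁ := E') (F₂ := E') (F₃ := ℝ)
    (E₁ := fun x : N ↦ TangentSpace J x) (E₂ := fun x : N ↦ TangentSpace J x)
    (E₃ := Bundle.Trivial N ℝ) (b := F) (x := x) (IM := I) (IB := J) (n := ∞)
    (ψ := fun y ↦ B (F y)) ((hB (F x)).comp x (hF x)) (key e) (key e')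
  rw [contMDiffAt_totalSpace] at h2
  refine h2.2.congr_of_eventuallyEq ?_
  filter_upwards [t.open_baseSet.mem_nhds hx] with y hy
  rw [inCoordinates_apply_eq₂ (F₃ := ℝ) (E₃ := Bundle.Trivial M ℝ) hy hy (by trivial)]
  simp [pullback_apply, t]
end Pullback

section Product
variable {E : Type*} [NormedAddCommGroup E] [NormedSpace ℝ E]
  {H : Type*} [TopologicalSpace H] {I : ModelWithCorners ℝ E H}
  {M : Type*} [TopologicalSpace M] [ChartedSpace H M]
  {E' : Type*} [NormedAddCommGroup E'] [NormedSpace ℝ E']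
  {H' : Type*} [TopologicalSpace H'] {J : ModelWithCorners ℝ E' H'}
  {N : Type*} [TopologicalSpace N] [ChartedSpace H' N]

theorem pullback_fst_apply (B : BilinField I M) (p : M × N) (u v : TangentSpace (I.prod J) p) :
    pullback (I := I.prod J) Prod.fst B p u v = B p.1 u.1 v.1 := by
  rw [pullback_apply, mfderiv_fst]; rfl

theorem pullback_snd_apply (B : BilinField J N) (p : M × N) (u v : TangentSpace (I.prod J) p) :
    pullback (I := I.prod J) Prod.snd B p u v = B p.2 u.2 v.2 := by
  rw [pullback_apply, mfderiv_snd]; rfl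

variable [IsManifold I ∞ M] [IsManifold J ∞ N]

theorem SmoothMetric.self_nonneg (g : SmoothMetric I M) (x : M) (v : TangentSpace I x) :
    0 ≤ g.inner x v v := by
  by_cases h : v = 0
  · simp [h]
  · exact (g.pos x v h).le

variable [FiniteDimensional ℝ E] [FiniteDimensional ℝ E']

/-- The product metric `g₁ ⊕ g₂` on `M × N`. -/
def prodMetric (g₁ : SmoothMetric I M) (g₂ : SmoothMetric J N) :
    SmoothMetric (I.prod J) (M × N) where
  inner := pullback Prod.fst g₁.inner + pullback Prod.snd g₂.inner
  symm p u v := by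
    simp only [Pi.add_apply, add_apply, pullback_apply]
    rw [g₁.symm, g₂.symm]
  pos p v hv := by
    simp only [Pi.add_apply, add_apply, pullback_fst_apply, pullback_snd_apply]
    have h : v.1 ≠ 0 ∨ v.2 ≠ 0 := by
      by_contra hc
      push Not at hc
      exact hv (Prod.ext hc.1 hc.2)
    rcases h with h | h
    · exact add_pos_of_pos_of_nonneg (g₁.pos _ _ h) (g₂.self_nonneg _ _)
    · exact add_pos_of_nonneg_of_pos (g₁.self_nonneg _ _) (g₂.pos _ _ h)
  isVonNBounded p := by
    have h₁ : Bornology.IsBounded {v : E | g₁.inner p.1 v v < 1} :=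
      (NormedSpace.isVonNBounded_iff ℝ).1 (g₁.isVonNBounded p.1)
    have h₂ : Bornology.IsBounded {v : E' | g₂.inner p.2 v v < 1} :=
      (NormedSpace.isVonNBounded_iff ℝ).1 (g₂.isVonNBounded p.2)
    have h : Bornology.IsVonNBounded ℝ
        ({v : E | g₁.inner p.1 v v < 1} ×ˢ {v : E' | g₂.inner p.2 v v < 1}) :=
      (NormedSpace.isVonNBounded_iff ℝ).2 (h₁.prod h₂)
    refine Bornology.IsVonNBounded.subset ?_ h
    intro v hv
    simp only [Set.mem_ofPred_eq, Pi.add_apply, add_apply, pullback_fst_apply,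
      pullback_snd_apply] at hv
    have h1 := g₁.self_nonneg p.1 v.1
    have h2 := g₂.self_nonneg p.2 v.2
    exact ⟨by simp only [Set.mem_ofPred_eq]; linarith, by simp only [Set.mem_ofPred_eq]; linarith⟩
  contMDiff :=
    IsSmoothBilin.add
      (isSmoothBilin_pullback contMDiff_fst g₁.contMDiff)
      (isSmoothBilin_pullback contMDiff_snd g₂.contMDiff)

end Product

section Immersion
variable {E : Type*} [NormedAddCommGroup E] [NormedSpace ℝ E]
  {H : Type*} [TopologicalSpace H] (I : ModelWithCorners ℝ E H)
  {M : Type*} [TopologicalSpace M] [ChartedSpace H M]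
  {E' : Type*} [NormedAddCommGroup E'] [NormedSpace ℝ E']
  {H' : Type*} [TopologicalSpace H'] (J : ModelWithCorners ℝ E' H')
  {N : Type*} [TopologicalSpace N] [ChartedSpace H' N]

/-- `F` is a smooth immersion: it is smooth and its differential is injective everywhere. -/
def IsSmoothImmersion (F : M → N) : Prop :=
  ContMDiff I J ∞ F ∧ ∀ x, Function.Injective (mfderiv I J F x)

/-- `F` is a Lagrangian immersion for the 2-form `Ω`: an immersion of half the dimension with
`F^*Ω = 0`. -/
def IsLagrangianImmersion (Ω : BilinField J N) (F : M → N) : Prop :=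
  IsSmoothImmersion I J F ∧ 2 * Module.finrank ℝ E = Module.finrank ℝ E' ∧
    pullback (I := I) F Ω = 0

/-- `F` is a minimal immersion into `(N, h)`: an immersion whose mean curvature vector vanishes.
For `x : M`, let `V i` be vector fields on `M` and `W i` vector fields on `N`, smooth near `x` and
`F x`, with `dF (V i) = W i ∘ F` near `x` and with `W i (F x)` orthonormal for `h`. Then the normal
part of `∇_{W i} (W i)` at `F x` is the second fundamental form at `V i x`, and the mean curvature
vector is the sum of these over `i`; it vanishes when its product with every normal vector `ν`
does. -/
def IsMinimalImmersion [IsManifold I ∞ M] [IsManifold J ∞ N] [FiniteDimensional ℝ E']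
    (h : SmoothMetric J N) (F : M → N) : Prop :=
  IsSmoothImmersion I J F ∧
  ∀ (x : M) (V : Fin (Module.finrank ℝ E) → Π y : M, TangentSpace I y)
    (W : Fin (Module.finrank ℝ E) → Π z : N, TangentSpace J z),
    (∀ i, CMDiffAt ∞ (T% (V i)) x) → (∀ i, CMDiffAt ∞ (T% (W i)) (F x)) →
    (∀ i, ∀ᶠ y in 𝓝 x, mfderiv I J F y (V i y) = W i (F y)) →
    (∀ i j, h.inner (F x) (W i (F x)) (W j (F x)) = if i = j then 1 else 0) →
    ∀ ν : TangentSpace J (F x), (∀ v : TangentSpace I x, h.inner (F x) (mfderiv I J F x v) ν = 0) →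
      ∑ i, h.inner (F x) (leviCivita h (W i) (F x) (W i (F x))) ν = 0

end Immersion

section Surface
variable {S : Type*} [TopologicalSpace S] [ChartedSpace (EuclideanSpace ℝ (Fin 2)) S]
  {S' : Type*} [TopologicalSpace S'] [ChartedSpace (EuclideanSpace ℝ (Fin 2)) S']

/-- `(S, g)` is a spherical surface: its Gaussian curvature is constant, equal to `1`. -/
def IsSpherical [IsManifold (𝓡 2) ∞ S] (g : SmoothMetric (𝓡 2) S) : Prop :=
  HasConstantCurvature g 1

/-- `dA` is the area form of `g` for some orientation of the surface: a smooth 2-form with values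
`±1` on orthonormal pairs. The choice of `dA` is the choice of the orientation, for which `(u, v)` is
positive when `0 < dA u v`. -/
structure IsAreaForm [IsManifold (𝓡 2) ∞ S] (g : SmoothMetric (𝓡 2) S) (dA : BilinField (𝓡 2) S) :
    Prop where
  smooth : IsSmoothBilin (𝓡 2) S dA
  alternating : ∀ x v, dA x v v = 0
  orthonormal : ∀ (x : S) (u v : TangentSpace (𝓡 2) x), g.inner x u u = 1 → g.inner x v v = 1 →
    g.inner x u v = 0 → |dA x u v| = 1

/-- The differential of `φ` maps positive bases to positive bases, for the orientations given by the
area forms `dA` and `dA'`. -/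
def IsOrientationPreserving (dA : BilinField (𝓡 2) S) (dA' : BilinField (𝓡 2) S') (φ : S → S') :
    Prop :=
  ∀ (x : S) (u v : TangentSpace (𝓡 2) x), 0 < dA x u v → 0 < pullback φ dA' x u v

/-- The symplectic form `π₁^*dA - π₂^*dA'` on `S × S'`. -/
def prodSymplectic (dA : BilinField (𝓡 2) S) (dA' : BilinField (𝓡 2) S') :
    BilinField ((𝓡 2).prod (𝓡 2)) (S × S') :=
  pullback Prod.fst dA - pullback Prod.snd dA'

/-- The graph of `φ`, as the embedding `x ↦ (x, φ x)`. -/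
def graphMap (φ : S → S') : S → S × S' := fun x ↦ (x, φ x)

/-- The graph of `φ` is a minimal Lagrangian submanifold of `S × S'`, with the metric `g ⊕ g'` and
the symplectic form `π₁^*dA - π₂^*dA'`. -/
def GraphIsMinimalLagrangian [IsManifold (𝓡 2) ∞ S] [IsManifold (𝓡 2) ∞ S']
    (g : SmoothMetric (𝓡 2) S) (g' : SmoothMetric (𝓡 2) S')
    (dA : BilinField (𝓡 2) S) (dA' : BilinField (𝓡 2) S') (φ : S → S') : Prop :=
  IsMinimalImmersion (𝓡 2) ((𝓡 2).prod (𝓡 2)) (prodMetric g g') (graphMap φ) ∧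
    IsLagrangianImmersion (𝓡 2) ((𝓡 2).prod (𝓡 2)) (prodSymplectic dA dA') (graphMap φ)

end Surface

end MinLag

end

/-! Write F(x) = (x, φ(x)), let ∇¹ and ∇² be the Levi-Civita connections of g₁ and g₂, and let D =
φ^*∇² - ∇¹, a symmetric tensor because both connections are torsion-free.

Minimality. The product connection acts factorwise, so the derivative of dF(V) along itself is (∇¹_V
V, dφ((φ^*∇²)_V V)). Subtracting the tangent vector dF((φ^*∇²)_V V) leaves (-D(V,V), 0), whose
normal part is the second fundamental form. The first component of a normal vector is arbitrary, so
the mean curvature vanishes exactly when the trace of D for the induced metric g₁ + φ^*g₂ does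
(`isMinimalImmersion_graph_iff`). This part holds in every dimension.

Lagrangian condition. Since φ preserves orientation, φ^*dA₂ = (det b) dA₁, so F^*(π₁^*dA₁ - π₂^*dA₂)
= 0 means det b = 1 (`isLagrangianImmersion_graphMap_iff`).

Codazzi equation. Assume det b = 1, and let X₁, X₂ be a g₁-orthonormal eigenbasis of b at a point,
with eigenvalues l, m and lm = 1. The induced metric is diag(1 + l², 1 + m²), so up to a positive
factor the trace is D(X₁,X₁) + l² D(X₂,X₂). As φ^*∇² preserves g₁(b·, b·) and ∇¹ preserves g₁, D is
expressed through ∇b (`inner_connectionDiff_add`). Together with the self-adjointness of ∇b and the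
derivative of det b = 1, this gives the X₁-component of the trace as -(l + m) g₁(d^∇b(X₁,X₂), X₂)
(`IsEigenbasis.inner_trace_connectionDiff`). The X₂-component follows by exchanging the
eigenvectors. Since l + m > 0, the trace and d^∇b vanish together. -/

noncomputable section

namespace MinLag

/-! ### Product vector fields and the Levi-Civita connection of a product metric -/

section ProductField
variable {E : Type*} [NormedAddCommGroup E] [NormedSpace ℝ E]
  {H : Type*} [TopologicalSpace H] {I : ModelWithCorners ℝ E H}
  {M : Type*} [TopologicalSpace M] [ChartedSpace H M]
  {E' : Type*} [NormedAddCommGroup E'] [NormedSpace ℝ E']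
  {H' : Type*} [TopologicalSpace H'] {J : ModelWithCorners ℝ E' H'}
  {N : Type*} [TopologicalSpace N] [ChartedSpace H' N]

variable (I) in
theorem exists_contMDiffAt_field_eq [IsManifold I ∞ M] {x : M} (v : TangentSpace I x) :
    ∃ X : Π y : M, TangentSpace I y, CMDiffAt ∞ (T% X) x ∧ X x = v :=
  ⟨extend E v, contMDiffAt_extend I E v, extend_apply_self E v⟩

/-- The vector field `(A, B)` on `M × N`. -/
def prodField (A : Π x : M, TangentSpace I x) (B : Π y : N, TangentSpace J y) :
    Π p : M × N, TangentSpace (I.prod J) p :=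
  fun p ↦ (A p.1, B p.2)

theorem contMDiffAt_prodField [IsManifold I 1 M] [IsManifold J 1 N]
    {A : Π x : M, TangentSpace I x} {B : Π y : N, TangentSpace J y} {p : M × N} {n : ℕ∞ω}
    (hA : CMDiffAt n (T% A) p.1) (hB : CMDiffAt n (T% B) p.2) :
    CMDiffAt n (T% (prodField A B)) p :=
  (contMDiff_equivTangentBundleProd_symm (I := I) (I' := J) (M := M) (M' := N) (n := n) _).comp p
    ((hA.comp p contMDiffAt_fst).prodMk (hB.comp p contMDiffAt_snd))

theorem mdifferentiableAt_prodField [IsManifold I 1 M] [IsManifold J 1 N]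
    {A : Π x : M, TangentSpace I x} {B : Π y : N, TangentSpace J y} {p : M × N}
    (hA : MDiffAt (T% A) p.1) (hB : MDiffAt (T% B) p.2) :
    MDiffAt (T% (prodField A B)) p :=
  ((contMDiff_equivTangentBundleProd_symm (I := I) (I' := J) (M := M) (M' := N) (n := 1)
    _).mdifferentiableAt one_ne_zero).comp p
    ((hA.comp p mdifferentiableAt_fst).prodMk (hB.comp p mdifferentiableAt_snd))

theorem inverse_prodMap {F₁ F₂ G₁ G₂ : Type*} [AddCommGroup F₁] [TopologicalSpace F₁] [Module ℝ F₁]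
    [AddCommGroup F₂] [TopologicalSpace F₂] [Module ℝ F₂]
    [AddCommGroup G₁] [TopologicalSpace G₁] [Module ℝ G₁]
    [AddCommGroup G₂] [TopologicalSpace G₂] [Module ℝ G₂]
    {f : F₁ →L[ℝ] G₁} {g : F₂ →L[ℝ] G₂} (hf : f.IsInvertible) (hg : g.IsInvertible) :
    (f.prodMap g).inverse = f.inverse.prodMap g.inverse := by
  obtain ⟨e, rfl⟩ := hf
  obtain ⟨e', rfl⟩ := hg
  rw [ContinuousLinearMap.inverse_equiv, ContinuousLinearMap.inverse_equiv]
  exact ContinuousLinearMap.inverse_equiv (e.prodCongr e')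

theorem inverse_apply_of_eq_prodMap {D : E × E' →L[ℝ] E × E'} {f : E →L[ℝ] E} {g : E' →L[ℝ] E'}
    (h : D = f.prodMap g) (hf : f.IsInvertible) (hg : g.IsInvertible) (v : E × E') :
    D.inverse v = (f.inverse v.1, g.inverse v.2) := by
  rw [h, inverse_prodMap hf hg]
  rfl

theorem lieBracket_prodMap {A A' : E → E} {B B' : E' → E'} {p : E × E'}
    (hA : DifferentiableAt ℝ A p.1) (hA' : DifferentiableAt ℝ A' p.1)
    (hB : DifferentiableAt ℝ B p.2) (hB' : DifferentiableAt ℝ B' p.2) :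
    lieBracket ℝ (Prod.map A B) (Prod.map A' B') p
      = (lieBracket ℝ A A' p.1, lieBracket ℝ B B' p.2) := by
  simp only [lieBracket_eq]
  rw [(hA.hasFDerivAt.prodMap p hB.hasFDerivAt).fderiv,
    (hA'.hasFDerivAt.prodMap p hB'.hasFDerivAt).fderiv]
  rfl

/-- The extended chart of a product is a product of charts, so the derivative of its inverse is
block diagonal, and so is the inverse of that derivative. -/
theorem mpullbackWithin_prodField [IsManifold I 1 M] [IsManifold J 1 N]
    (A : Π x : M, TangentSpace I x) (B : Π y : N, TangentSpace J y) (p : M × N) {z : E × E'}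
    (hz : z ∈ (extChartAt (I.prod J) p).target) :
    mpullbackWithin 𝓘(ℝ, E × E') (I.prod J) (extChartAt (I.prod J) p).symm (prodField A B)
      (Set.range (I.prod J)) z =
    Prod.map (mpullbackWithin 𝓘(ℝ, E) I (extChartAt I p.1).symm A (Set.range I))
      (mpullbackWithin 𝓘(ℝ, E') J (extChartAt J p.2).symm B (Set.range J)) z := by
  rw [extChartAt_prod] at hz ⊢
  have h1 : z.1 ∈ (extChartAt I p.1).target := hz.1
  have h2 : z.2 ∈ (extChartAt J p.2).target := hz.2
  have key : mfderivWithin 𝓘(ℝ, E × E') (I.prod J)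
      ((extChartAt I p.1).prod (extChartAt J p.2)).symm (Set.range (I.prod J)) z =
    (mfderivWithin 𝓘(ℝ, E) I (extChartAt I p.1).symm (Set.range I) z.1).prodMap
      (mfderivWithin 𝓘(ℝ, E') J (extChartAt J p.2).symm (Set.range J) z.2) := by
    rw [ModelWithCorners.range_prod, modelWithCornersSelf_prod, ← chartedSpaceSelf_prod]
    exact mfderivWithin_prodMap (mdifferentiableWithinAt_extChartAt_symm h1)
      (mdifferentiableWithinAt_extChartAt_symm h2)
      (I.uniqueDiffOn.uniqueMDiffOn _ (extChartAt_target_subset_range _ h1))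
      (J.uniqueDiffOn.uniqueMDiffOn _ (extChartAt_target_subset_range _ h2))
  exact inverse_apply_of_eq_prodMap (E := E) (E' := E') key
    (isInvertible_mfderivWithin_extChartAt_symm h1) (isInvertible_mfderivWithin_extChartAt_symm h2) _

theorem mfderiv_extChartAt_prod [IsManifold I 1 M] [IsManifold J 1 N] (p : M × N) :
    mfderiv (I.prod J) 𝓘(ℝ, E × E') (extChartAt (I.prod J) p) p =
    (mfderiv I 𝓘(ℝ, E) (extChartAt I p.1) p.1).prodMap
      (mfderiv J 𝓘(ℝ, E') (extChartAt J p.2) p.2) := by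
  rw [extChartAt_prod, modelWithCornersSelf_prod, ← chartedSpaceSelf_prod]
  exact mfderiv_prodMap (mdifferentiableAt_extChartAt (mem_chart_source _ _))
    (mdifferentiableAt_extChartAt (mem_chart_source _ _))

theorem differentiableAt_mpullback_extChartAt_symm
    [IsManifold I ∞ M] [I.Boundaryless] [CompleteSpace E]
    {A : Π x : M, TangentSpace I x} {x : M} (hA : MDiffAt (T% A) x) :
    DifferentiableAt ℝ (mpullbackWithin 𝓘(ℝ, E) I (extChartAt I x).symm A (Set.range I))
      (extChartAt I x x) := by
  have h := MDifferentiableWithinAt.differentiableWithinAt_mpullbackWithin_vectorField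
    (mdifferentiableWithinAt_univ.2 hA)
  rw [Set.preimage_univ, Set.univ_inter] at h
  exact h.differentiableAt (by rw [I.range_eq_univ]; exact Filter.univ_mem)

/-- Without boundary the model has full range, so the bracket within the range of the model is the
ordinary bracket of the vector space. -/
theorem mlieBracket_eq_lieBracket_extChartAt [I.Boundaryless] (A A' : Π x : M, TangentSpace I x)
    (x : M) :
    mlieBracket I A A' x = (mfderiv I 𝓘(ℝ, E) (extChartAt I x) x).inverse
      (lieBracket ℝ (E := E) (mpullbackWithin 𝓘(ℝ, E) I (extChartAt I x).symm A (Set.range I))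
        (mpullbackWithin 𝓘(ℝ, E) I (extChartAt I x).symm A' (Set.range I)) (extChartAt I x x)) := by
  have h : ∀ V W : E → E, lieBracketWithin ℝ V W
      ((extChartAt I x).symm ⁻¹' Set.univ ∩ Set.range I) = lieBracket ℝ V W := by
    intro V W
    rw [Set.preimage_univ, Set.univ_inter, I.range_eq_univ, lieBracketWithin_univ]
  rw [← mlieBracketWithin_univ, mlieBracketWithin_apply]
  exact congrArg _ (congrFun (h _ _) _)

theorem mlieBracket_prodField [IsManifold I ∞ M] [IsManifold J ∞ N] [I.Boundaryless]
    [J.Boundaryless] [CompleteSpace E] [CompleteSpace E']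
    {A A' : Π x : M, TangentSpace I x} {B B' : Π y : N, TangentSpace J y} {p : M × N}
    (hA : MDiffAt (T% A) p.1) (hA' : MDiffAt (T% A') p.1)
    (hB : MDiffAt (T% B) p.2) (hB' : MDiffAt (T% B') p.2) :
    mlieBracket (I.prod J) (prodField A B) (prodField A' B') p
      = (mlieBracket I A A' p.1, mlieBracket J B B' p.2) := by
  -- In the chart the fields split only over the chart target; this suffices because the bracket
  -- depends only on germs.
  have hmem : ∀ᶠ z in 𝓝 (extChartAt (I.prod J) p p), z ∈ (extChartAt (I.prod J) p).target :=
    (isOpen_extChartAt_target p).mem_nhds (mem_extChartAt_target p)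
  have hbr := Filter.EventuallyEq.lieBracket_vectorField_eq (𝕜 := ℝ)
    (hmem.mono fun z hz ↦ mpullbackWithin_prodField A B p hz)
    (hmem.mono fun z hz ↦ mpullbackWithin_prodField A' B' p hz)
  have hbr' := lieBracket_prodMap (p := extChartAt (I.prod J) p p)
    (differentiableAt_mpullback_extChartAt_symm hA)
    (differentiableAt_mpullback_extChartAt_symm hA')
    (differentiableAt_mpullback_extChartAt_symm hB)
    (differentiableAt_mpullback_extChartAt_symm hB')
  rw [mlieBracket_eq_lieBracket_extChartAt, mlieBracket_eq_lieBracket_extChartAt,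
    mlieBracket_eq_lieBracket_extChartAt]
  refine Eq.trans (congrArg _ (hbr.trans hbr')) ?_
  exact inverse_apply_of_eq_prodMap (E := E) (E' := E') (mfderiv_extChartAt_prod p)
    (isInvertible_mfderiv_extChartAt (mem_extChartAt_source _))
    (isInvertible_mfderiv_extChartAt (mem_extChartAt_source _)) _

variable [IsManifold I ∞ M] [IsManifold J ∞ N] [FiniteDimensional ℝ E] [FiniteDimensional ℝ E']

theorem prodMetric_inner_apply (g₁ : SmoothMetric I M) (g₂ : SmoothMetric J N) (p : M × N)
    (u v : TangentSpace (I.prod J) p) :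
    (prodMetric g₁ g₂).inner p u v = g₁.inner p.1 u.1 v.1 + g₂.inner p.2 u.2 v.2 := by
  rw [← pullback_fst_apply (J := J) g₁.inner p u v, ← pullback_snd_apply (I := I) g₂.inner p u v]
  rfl

theorem prodMetric_pair_prodField (g₁ : SmoothMetric I M) (g₂ : SmoothMetric J N)
    (A A' : Π x : M, TangentSpace I x) (B B' : Π y : N, TangentSpace J y) :
    (prodMetric g₁ g₂).pair (prodField A B) (prodField A' B') =
      g₁.pair A A' ∘ Prod.fst + g₂.pair B B' ∘ Prod.snd :=
  funext fun p ↦ prodMetric_inner_apply g₁ g₂ p _ _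

theorem mvfderiv_prodMetric_pair_prodField (g₁ : SmoothMetric I M) (g₂ : SmoothMetric J N)
    {A A' : Π x : M, TangentSpace I x} {B B' : Π y : N, TangentSpace J y} {p : M × N}
    (hA : MDiffAt (T% A) p.1) (hA' : MDiffAt (T% A') p.1)
    (hB : MDiffAt (T% B) p.2) (hB' : MDiffAt (T% B') p.2) (v : TangentSpace (I.prod J) p) :
    mvfderiv (I.prod J) ((prodMetric g₁ g₂).pair (prodField A B) (prodField A' B')) p v =
      mvfderiv I (g₁.pair A A') p.1 v.1 + mvfderiv J (g₂.pair B B') p.2 v.2 := by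
  have h₁ := g₁.mdifferentiableAt_pair hA hA'
  have h₂ := g₂.mdifferentiableAt_pair hB hB'
  rw [prodMetric_pair_prodField,
    mvfderiv_add (h₁.comp p mdifferentiableAt_fst) (h₂.comp p mdifferentiableAt_snd)]
  refine (congrArg₂ (· + ·) (mvfderiv_comp_apply p h₁ mdifferentiableAt_fst v)
    (mvfderiv_comp_apply p h₂ mdifferentiableAt_snd v)).trans ?_
  rw [mfderiv_fst, mfderiv_snd]
  rfl

theorem prodMetric_inner_mlieBracket [I.Boundaryless] [J.Boundaryless]
    (g₁ : SmoothMetric I M) (g₂ : SmoothMetric J N)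
    {X Y Z : Π x : M, TangentSpace I x} {X' Y' Z' : Π y : N, TangentSpace J y} {p : M × N}
    (hX : MDiffAt (T% X) p.1) (hY : MDiffAt (T% Y) p.1)
    (hX' : MDiffAt (T% X') p.2) (hY' : MDiffAt (T% Y') p.2) :
    (prodMetric g₁ g₂).inner p (mlieBracket (I.prod J) (prodField X X') (prodField Y Y') p)
      (prodField Z Z' p) =
      g₁.inner p.1 (mlieBracket I X Y p.1) (Z p.1)
        + g₂.inner p.2 (mlieBracket J X' Y' p.2) (Z' p.2) := by
  have := FiniteDimensional.complete ℝ E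
  have := FiniteDimensional.complete ℝ E'
  rw [mlieBracket_prodField hX hY hX' hY']
  exact prodMetric_inner_apply g₁ g₂ p _ _

theorem koszul_prodMetric [I.Boundaryless] [J.Boundaryless]
    (g₁ : SmoothMetric I M) (g₂ : SmoothMetric J N)
    {Y X Z : Π x : M, TangentSpace I x} {Y' X' Z' : Π y : N, TangentSpace J y} {p : M × N}
    (hY : MDiffAt (T% Y) p.1) (hX : MDiffAt (T% X) p.1) (hZ : MDiffAt (T% Z) p.1)
    (hY' : MDiffAt (T% Y') p.2) (hX' : MDiffAt (T% X') p.2) (hZ' : MDiffAt (T% Z') p.2) :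
    koszul (prodMetric g₁ g₂) (prodField Y Y') (prodField X X') (prodField Z Z') p =
      koszul g₁ Y X Z p.1 + koszul g₂ Y' X' Z' p.2 := by
  simp only [koszul, mvfderiv_prodMetric_pair_prodField g₁ g₂ hY hZ hY' hZ',
    mvfderiv_prodMetric_pair_prodField g₁ g₂ hX hZ hX' hZ',
    mvfderiv_prodMetric_pair_prodField g₁ g₂ hX hY hX' hY',
    prodMetric_inner_mlieBracket g₁ g₂ hX hY hX' hY',
    prodMetric_inner_mlieBracket g₁ g₂ hX hZ hX' hZ',
    prodMetric_inner_mlieBracket g₁ g₂ hY hZ hY' hZ']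
  simp only [prodField]
  ring

/-- The Levi-Civita connection of a product metric, on product vector fields. -/
theorem leviCivita_prodMetric [I.Boundaryless] [J.Boundaryless]
    (g₁ : SmoothMetric I M) (g₂ : SmoothMetric J N)
    {Y : Π x : M, TangentSpace I x} {Y' : Π y : N, TangentSpace J y} {p : M × N}
    (hY : MDiffAt (T% Y) p.1) (hY' : MDiffAt (T% Y') p.2) (v : TangentSpace (I.prod J) p) :
    leviCivita (prodMetric g₁ g₂) (prodField Y Y') p v =
      (leviCivita g₁ Y p.1 v.1, leviCivita g₂ Y' p.2 v.2) := by
  refine (prodMetric g₁ g₂).ext_inner fun w ↦ ?_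
  -- Both sides depend on `v` and `w` only as vectors, so their components may be extended
  -- separately in the two factors. Only product fields then enter the Koszul formula.
  obtain ⟨X, hX, hXv⟩ := exists_contMDiffAt_field_eq I (x := p.1) v.1
  obtain ⟨X', hX', hXv'⟩ := exists_contMDiffAt_field_eq J (x := p.2) v.2
  obtain ⟨Z, hZ, hZw⟩ := exists_contMDiffAt_field_eq I (x := p.1) w.1
  obtain ⟨Z', hZ', hZw'⟩ := exists_contMDiffAt_field_eq J (x := p.2) w.2
  obtain rfl : prodField X X' p = v := Prod.ext hXv hXv'
  obtain rfl : prodField Z Z' p = w := Prod.ext hZw hZw'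
  replace hX := hX.mdifferentiableAt (by simp)
  replace hX' := hX'.mdifferentiableAt (by simp)
  replace hZ := hZ.mdifferentiableAt (by simp)
  replace hZ' := hZ'.mdifferentiableAt (by simp)
  refine (inner_leviCivitaFun (prodMetric g₁ g₂) (mdifferentiableAt_prodField hX hX')
    (mdifferentiableAt_prodField hY hY') (mdifferentiableAt_prodField hZ hZ')).trans ?_
  rw [koszul_prodMetric g₁ g₂ hY hX hZ hY' hX' hZ', ← inner_leviCivitaFun g₁ hX hY hZ,
    ← inner_leviCivitaFun g₂ hX' hY' hZ']
  symm
  refine (prodMetric_inner_apply g₁ g₂ p _ _).trans ?_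
  rfl

end ProductField

/-! ### Derivatives along a map, push-forward of fields and pull-back of the connection -/

section Pushforward
variable {E' : Type*} [NormedAddCommGroup E'] [NormedSpace ℝ E']
  {H' : Type*} [TopologicalSpace H'] {J : ModelWithCorners ℝ E' H'}
  {N : Type*} [TopologicalSpace N] [ChartedSpace H' N]
  {E : Type*} [NormedAddCommGroup E] [NormedSpace ℝ E]
  {H : Type*} [TopologicalSpace H] {I : ModelWithCorners ℝ E H}
  {M : Type*} [TopologicalSpace M] [ChartedSpace H M]

/-- The derivative of a vector field along a direction tangent to the image of `F` only depends on
the values of the field along `F`. -/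
theorem leviCivita_congr_along [IsManifold J ∞ N] [FiniteDimensional ℝ E']
    (g : SmoothMetric J N) {F : M → N} {x : M} {W W' : Π z : N, TangentSpace J z}
    (hF : MDiffAt F x) (hW : MDiffAt (T% W) (F x)) (hW' : MDiffAt (T% W') (F x))
    (h : ∀ᶠ y in 𝓝 x, W (F y) = W' (F y)) (v : TangentSpace I x) :
    leviCivita g W (F x) (mfderiv I J F x v) = leviCivita g W' (F x) (mfderiv I J F x v) := by
  refine g.ext_inner fun w ↦ ?_
  obtain ⟨X, hX, hXv⟩ := exists_contMDiffAt_field_eq J (mfderiv I J F x v)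
  obtain ⟨Z, hZ, rfl⟩ := exists_contMDiffAt_field_eq J w
  replace hX := hX.mdifferentiableAt (by simp)
  replace hZ := hZ.mdifferentiableAt (by simp)
  -- In g(∇_X W, Z) = X(g(W, Z)) - g(W, ∇_X Z) with X = dF(v), the first term is the derivative
  -- along v of g(W, Z) ∘ F, and the second involves only the value of W at F(x).
  have h₁ := leviCivita_metric g hX hW hZ
  have h₂ := leviCivita_metric g hX hW' hZ
  have h₃ : mvfderiv I (g.pair W Z ∘ F) x = mvfderiv I (g.pair W' Z ∘ F) x :=
    Filter.EventuallyEq.mfderiv_eq (h.mono fun y hy ↦ by simp [SmoothMetric.pair, hy])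
  have h₄ := mvfderiv_comp_apply x (g.mdifferentiableAt_pair hW hZ) hF v
  have h₅ := mvfderiv_comp_apply x (g.mdifferentiableAt_pair hW' hZ) hF v
  rw [h₃] at h₄
  rw [hXv, ← h₄] at h₁
  rw [hXv, ← h₅] at h₂
  rw [h.self_of_nhds] at h₁
  linarith

theorem mfderiv_symm_mfderiv (φ : M ≃ₘ⟮I, J⟯ N) (x : M) (v : TangentSpace I x) :
    (mfderiv J I φ.symm (φ x) (mfderiv I J φ x v) : E) = v := by
  have h := mfderiv_comp_apply x (φ.symm.mdifferentiable (by simp) (φ x))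
    (φ.mdifferentiable (by simp) x) v
  have h' : φ.symm ∘ φ = id := funext φ.symm_apply_apply
  rw [← h, h', mfderiv_id]
  rfl

theorem isInvertible_mfderiv_symm (φ : M ≃ₘ⟮I, J⟯ N) (y : N) :
    (mfderiv J I φ.symm y).IsInvertible :=
  ⟨φ.symm.mfderivToContinuousLinearEquiv (by simp) y, rfl⟩

/-- The push-forward `φ_*V` of a vector field by a diffeomorphism. -/
def pushField (φ : M ≃ₘ⟮I, J⟯ N) (V : Π x : M, TangentSpace I x) : Π y : N, TangentSpace J y :=
  mpullback J I φ.symm V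

theorem pushField_apply (φ : M ≃ₘ⟮I, J⟯ N) (V : Π x : M, TangentSpace I x) (x : M) :
    pushField φ V (φ x) = mfderiv I J φ x (V x) := by
  refine (isInvertible_mfderiv_symm φ (φ x)).inverse_apply_eq.2 ?_
  refine Eq.trans ?_ (mfderiv_symm_mfderiv φ x (V x)).symm
  -- The fibres over φ⁻¹(φ(x)) and x are both the model space `E`, where the two values can be
  -- compared without transport.
  have : ∀ z, z = x → (V z : E) = V x := by rintro _ rfl; rfl
  exact this _ (φ.symm_apply_apply x)

variable [FiniteDimensional ℝ E'] [IsManifold J ∞ N]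

/-- The pull-back `φ^*∇` to `M` of the Levi-Civita connection of `(N, g)`;
`pullLeviCivita g φ Y x v` is `(φ^*∇)_v Y` at `x`. -/
def pullLeviCivita (g : SmoothMetric J N) (φ : M ≃ₘ⟮I, J⟯ N) (Y : Π x : M, TangentSpace I x)
    (x : M) : TangentSpace I x →L[ℝ] TangentSpace I x :=
  (φ.mfderivToContinuousLinearEquiv (by simp) x).symm.toContinuousLinearMap ∘L
    leviCivita g (pushField φ Y) (φ x) ∘L mfderiv I J φ x

theorem mfderiv_pullLeviCivita (g : SmoothMetric J N) (φ : M ≃ₘ⟮I, J⟯ N)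
    (Y : Π x : M, TangentSpace I x) (x : M) (v : TangentSpace I x) :
    mfderiv I J φ x (pullLeviCivita g φ Y x v) =
      leviCivita g (pushField φ Y) (φ x) (mfderiv I J φ x v) :=
  (φ.mfderivToContinuousLinearEquiv (by simp) x).apply_symm_apply _

variable [IsManifold I ∞ M]

theorem contMDiffAt_pushField (φ : M ≃ₘ⟮I, J⟯ N) {V : Π x : M, TangentSpace I x} {x : M}
    (hV : CMDiffAt ∞ (T% V) x) : CMDiffAt ∞ (T% (pushField φ V)) (φ x) := by
  have := FiniteDimensional.complete ℝ E'
  exact ContMDiffAt.mpullback_vectorField_preimage (n := ∞) (by rwa [φ.symm_apply_apply])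
    φ.symm.contMDiff.contMDiffAt (isInvertible_mfderiv_symm φ _) (by simp)

theorem mdifferentiableAt_pushField (φ : M ≃ₘ⟮I, J⟯ N) {V : Π x : M, TangentSpace I x} {x : M}
    (hV : MDiffAt (T% V) x) : MDiffAt (T% (pushField φ V)) (φ x) := by
  have := FiniteDimensional.complete ℝ E'
  exact MDifferentiableAt.mpullback_vectorField (n := ∞) (by rwa [φ.symm_apply_apply])
    φ.symm.contMDiff.contMDiffAt (isInvertible_mfderiv_symm φ _) ENat.LEInfty.out

theorem mlieBracket_pushField (φ : M ≃ₘ⟮I, J⟯ N) {V W : Π x : M, TangentSpace I x} {x : M}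
    (hV : MDiffAt (T% V) x) (hW : MDiffAt (T% W) x) :
    mlieBracket J (pushField φ V) (pushField φ W) (φ x) =
      mfderiv I J φ x (mlieBracket I V W x) := by
  have := FiniteDimensional.complete ℝ E'
  have : IsManifold I (minSmoothness ℝ 2) M := by
    rw [minSmoothness_of_isRCLikeNormedField]; infer_instance
  have : IsManifold J (minSmoothness ℝ 2) N := by
    rw [minSmoothness_of_isRCLikeNormedField]; infer_instance
  rw [← pushField_apply]
  exact (mpullback_mlieBracket (n := ∞) (by rwa [φ.symm_apply_apply])
    (by rwa [φ.symm_apply_apply]) φ.symm.contMDiff.contMDiffAt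
    (by rw [minSmoothness_of_isRCLikeNormedField]; exact ENat.LEInfty.out)).symm

/-- Push-forward respects brackets, so the identity is transported by dφ. With
`pullLeviCivita_metric` it says that φ^*∇ behaves as the Levi-Civita connection of φ^*g. -/
theorem pullLeviCivita_torsion_free (g : SmoothMetric J N) (φ : M ≃ₘ⟮I, J⟯ N)
    {X Y : Π x : M, TangentSpace I x} {x : M} (hX : MDiffAt (T% X) x) (hY : MDiffAt (T% Y) x) :
    pullLeviCivita g φ Y x (X x) - pullLeviCivita g φ X x (Y x) = mlieBracket I X Y x := by
  apply (φ.mfderivToContinuousLinearEquiv (by simp) x).injective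
  change mfderiv I J φ x _ = mfderiv I J φ x _
  rw [map_sub, mfderiv_pullLeviCivita, mfderiv_pullLeviCivita, ← mlieBracket_pushField φ hX hY,
    ← pushField_apply, ← pushField_apply]
  exact leviCivita_torsion_free g (mdifferentiableAt_pushField φ hX)
    (mdifferentiableAt_pushField φ hY)

theorem pullLeviCivita_metric (g : SmoothMetric J N) (φ : M ≃ₘ⟮I, J⟯ N)
    {X Y Z : Π x : M, TangentSpace I x} {x : M}
    (hX : MDiffAt (T% X) x) (hY : MDiffAt (T% Y) x) (hZ : MDiffAt (T% Z) x) :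
    mvfderiv I (fun y ↦ pullback φ g.inner y (Y y) (Z y)) x (X x) =
      pullback φ g.inner x (pullLeviCivita g φ Y x (X x)) (Z x)
        + pullback φ g.inner x (Y x) (pullLeviCivita g φ Z x (X x)) := by
  have h : (fun y ↦ pullback φ g.inner y (Y y) (Z y)) =
      g.pair (pushField φ Y) (pushField φ Z) ∘ φ := by
    funext y
    simp only [pullback_apply, Function.comp_apply, SmoothMetric.pair, pushField_apply]
  have hX' := mdifferentiableAt_pushField φ hX
  have hY' := mdifferentiableAt_pushField φ hY
  have hZ' := mdifferentiableAt_pushField φ hZ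
  have h₁ := leviCivita_metric g hX' hY' hZ'
  simp only [pushField_apply, ← mfderiv_pullLeviCivita] at h₁
  rw [h, mvfderiv_comp_apply x (g.mdifferentiableAt_pair hY' hZ') (φ.mdifferentiable (by simp) x),
    h₁]
  rfl

end Pushforward

/-! ### Covariant derivative of a (1,1) tensor -/

section Tensor
variable {E : Type*} [NormedAddCommGroup E] [NormedSpace ℝ E]
  {H : Type*} [TopologicalSpace H] {I : ModelWithCorners ℝ E H}
  {M : Type*} [TopologicalSpace M] [ChartedSpace H M] [IsManifold I ∞ M]

theorem IsSmoothEndo.mdifferentiableAt_apply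
    {A : Π x : M, TangentSpace I x →L[ℝ] TangentSpace I x} (hA : IsSmoothEndo A)
    {Y : Π x : M, TangentSpace I x} {x : M} (hY : MDiffAt (T% Y) x) :
    MDiffAt (T% (fun y ↦ A y (Y y))) x :=
  MDifferentiableAt.clm_bundle_apply (E₁ := fun x : M ↦ TangentSpace I x)
    (E₂ := fun x : M ↦ TangentSpace I x) (b := id)
    ((hA x).mdifferentiableAt (by simp)) hY

variable [FiniteDimensional ℝ E]

/-- The covariant derivative `v ↦ (∇_v A) Y = ∇_v (A Y) - A (∇_v Y)` of a `(1,1)` tensor. -/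
def tensorDeriv (g : SmoothMetric I M) (A : Π x : M, TangentSpace I x →L[ℝ] TangentSpace I x)
    (Y : Π x : M, TangentSpace I x) (x : M) : TangentSpace I x →L[ℝ] TangentSpace I x :=
  leviCivita g (fun y ↦ A y (Y y)) x - A x ∘L leviCivita g Y x

theorem leviCivita_tensor_apply (g : SmoothMetric I M)
    (A : Π x : M, TangentSpace I x →L[ℝ] TangentSpace I x)
    (Y : Π x : M, TangentSpace I x) (x : M) (v : TangentSpace I x) :
    leviCivita g (fun y ↦ A y (Y y)) x v = tensorDeriv g A Y x v + A x (leviCivita g Y x v) := by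
  simp [tensorDeriv]

theorem extDerivTensor_eq_tensorDeriv (g : SmoothMetric I M)
    (A : Π x : M, TangentSpace I x →L[ℝ] TangentSpace I x)
    {X Y : Π x : M, TangentSpace I x} {x : M} (hX : MDiffAt (T% X) x) (hY : MDiffAt (T% Y) x) :
    extDerivTensor g A X Y x = tensorDeriv g A Y x (X x) - tensorDeriv g A X x (Y x) := by
  rw [extDerivTensor, ← leviCivita_torsion_free g hX hY, leviCivita_tensor_apply,
    leviCivita_tensor_apply, map_sub]
  abel

/-- Differentiating g(AY, Z) = g(Y, AZ) shows that each ∇_v A is again self-adjoint. -/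
theorem inner_tensorDeriv_comm (g : SmoothMetric I M)
    {A : Π x : M, TangentSpace I x →L[ℝ] TangentSpace I x} (hA : IsSmoothEndo A)
    (hsa : ∀ (x : M) (u v : TangentSpace I x), g.inner x (A x u) v = g.inner x u (A x v))
    {Y Z : Π x : M, TangentSpace I x} {x : M} (hY : MDiffAt (T% Y) x) (hZ : MDiffAt (T% Z) x)
    (v : TangentSpace I x) :
    g.inner x (tensorDeriv g A Y x v) (Z x) = g.inner x (tensorDeriv g A Z x v) (Y x) := by
  obtain ⟨X, hX, rfl⟩ := exists_contMDiffAt_field_eq I v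
  replace hX := hX.mdifferentiableAt (by simp)
  have h₁ := leviCivita_metric g hX (hA.mdifferentiableAt_apply hY) hZ
  have h₂ := leviCivita_metric g hX hY (hA.mdifferentiableAt_apply hZ)
  have h : g.pair (fun y ↦ A y (Y y)) Z = g.pair Y (fun y ↦ A y (Z y)) :=
    funext fun y ↦ hsa y _ _
  rw [h, h₂, leviCivita_tensor_apply, leviCivita_tensor_apply] at h₁
  simp only [map_add, add_apply, hsa] at h₁
  rw [g.symm x (tensorDeriv g A Z x (X x))]
  linarith

/-! ### The difference of the two connections -/

section Difference
variable {E' : Type*} [NormedAddCommGroup E'] [NormedSpace ℝ E'] [FiniteDimensional ℝ E']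
  {H' : Type*} [TopologicalSpace H'] {J : ModelWithCorners ℝ E' H'}
  {N : Type*} [TopologicalSpace N] [ChartedSpace H' N] [IsManifold J ∞ N]

/-- The difference `v ↦ (φ^*∇²)_v Y - ∇¹_v Y` of the pulled back Levi-Civita connection of `g₂` and
the Levi-Civita connection of `g₁`. -/
def connectionDiff (g₁ : SmoothMetric I M) (g₂ : SmoothMetric J N) (φ : M ≃ₘ⟮I, J⟯ N)
    (Y : Π x : M, TangentSpace I x) (x : M) : TangentSpace I x →L[ℝ] TangentSpace I x :=
  pullLeviCivita g₂ φ Y x - leviCivita g₁ Y x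

/-- Both connections are torsion-free, so the same bracket cancels. The symmetry also moves a field
into the linear slot, which makes the difference depend only on its value at the point. -/
theorem connectionDiff_comm (g₁ : SmoothMetric I M) (g₂ : SmoothMetric J N) (φ : M ≃ₘ⟮I, J⟯ N)
    {X Y : Π x : M, TangentSpace I x} {x : M} (hX : MDiffAt (T% X) x) (hY : MDiffAt (T% Y) x) :
    connectionDiff g₁ g₂ φ Y x (X x) = connectionDiff g₁ g₂ φ X x (Y x) := by
  have h := (pullLeviCivita_torsion_free g₂ φ hX hY).trans (leviCivita_torsion_free g₁ hX hY).symm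
  simp only [connectionDiff, sub_apply]
  rw [sub_eq_sub_iff_add_eq_add] at h ⊢
  rw [h, add_comm]

/-- If `φ^*g₂ = g₁(A·, A·)`, then the difference of the two connections is determined by the
covariant derivative of `A`. -/
theorem inner_connectionDiff_add (g₁ : SmoothMetric I M) (g₂ : SmoothMetric J N)
    (φ : M ≃ₘ⟮I, J⟯ N) {A : Π x : M, TangentSpace I x →L[ℝ] TangentSpace I x}
    (hA : IsSmoothEndo A)
    (hpull : ∀ (x : M) (u v : TangentSpace I x),
      pullback φ g₂.inner x u v = g₁.inner x (A x u) (A x v))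
    {Y Z : Π x : M, TangentSpace I x} {x : M} (hY : MDiffAt (T% Y) x) (hZ : MDiffAt (T% Z) x)
    (v : TangentSpace I x) :
    g₁.inner x (A x (connectionDiff g₁ g₂ φ Y x v)) (A x (Z x))
        + g₁.inner x (A x (Y x)) (A x (connectionDiff g₁ g₂ φ Z x v)) =
      g₁.inner x (tensorDeriv g₁ A Y x v) (A x (Z x))
        + g₁.inner x (A x (Y x)) (tensorDeriv g₁ A Z x v) := by
  obtain ⟨X, hX, rfl⟩ := exists_contMDiffAt_field_eq I v
  replace hX := hX.mdifferentiableAt (by simp)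
  -- The derivative of g₁(AY, AZ) along X is expanded in two ways: by φ^*∇², which preserves this
  -- form, and by ∇¹, which preserves g₁.
  have h₁ := pullLeviCivita_metric g₂ φ hX hY hZ
  have h₂ := leviCivita_metric g₁ hX (hA.mdifferentiableAt_apply hY) (hA.mdifferentiableAt_apply hZ)
  have h : (fun y ↦ pullback φ g₂.inner y (Y y) (Z y)) =
      g₁.pair (fun y ↦ A y (Y y)) (fun y ↦ A y (Z y)) := funext fun y ↦ hpull y _ _
  rw [h, h₂, leviCivita_tensor_apply, leviCivita_tensor_apply, hpull, hpull] at h₁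
  simp only [connectionDiff, sub_apply, map_sub, map_add, add_apply] at h₁ ⊢
  linarith

end Difference
end Tensor

/-- The spectral theorem in dimension two, for an inner product given by a bilinear form. -/
theorem exists_orthonormal_eigenbasis_of_finrank_eq_two {V : Type*} [AddCommGroup V] [Module ℝ V]
    (hdim : Module.finrank ℝ V = 2) (B : V →ₗ[ℝ] V →ₗ[ℝ] ℝ) (hsymm : ∀ u v, B u v = B v u)
    (hpos : ∀ v, v ≠ 0 → 0 < B v v) (T : V →ₗ[ℝ] V) (hT : ∀ u v, B (T u) v = B u (T v)) :
    ∃ (e₁ e₂ : V) (l m : ℝ), B e₁ e₁ = 1 ∧ B e₂ e₂ = 1 ∧ B e₁ e₂ = 0 ∧ T e₁ = l • e₁ ∧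
      T e₂ = m • e₂ ∧ LinearMap.det T = l * m ∧
      ∀ v, v = B v e₁ • e₁ + B v e₂ • e₂ := by
  -- The form `B` is made into the inner product of `V`, so that the spectral theorem for symmetric
  -- operators applies.
  let c : InnerProductSpace.Core ℝ V :=
    { inner := fun u v ↦ B u v
      conj_inner_symm := fun u v ↦ hsymm v u
      re_inner_nonneg := fun v ↦ by
        by_cases h : v = 0
        · simp [h]
        · exact (hpos v h).le
      add_left := fun u v w ↦ by simp
      smul_left := fun u v r ↦ by simp
      definite := fun v hv ↦ by
        by_contra h
        exact (hpos v h).ne' hv }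
  let : NormedAddCommGroup V := c.toNormedAddCommGroup
  let : InnerProductSpace ℝ V := InnerProductSpace.ofCore c.toCore
  have : FiniteDimensional ℝ V := FiniteDimensional.of_finrank_pos (by omega)
  have hT' : T.IsSymmetric := hT
  let b := hT'.eigenvectorBasis hdim
  have hinner : ∀ u v : V, inner ℝ u v = B u v := fun _ _ ↦ rfl
  have ho := b.orthonormal
  rw [orthonormal_iff_ite] at ho
  refine ⟨b 0, b 1, hT'.eigenvalues hdim 0, hT'.eigenvalues hdim 1, ?_, ?_, ?_, ?_, ?_, ?_, ?_⟩
  · exact (ho 0 0).trans (if_pos rfl)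
  · exact (ho 1 1).trans (if_pos rfl)
  · exact (ho 0 1).trans (if_neg (by simp))
  · exact hT'.apply_eigenvectorBasis hdim 0
  · exact hT'.apply_eigenvectorBasis hdim 1
  · simp [hT'.det_eq_prod_eigenvalues hdim, Fin.prod_univ_two]
  · intro v
    have := b.sum_repr' v
    rw [Fin.sum_univ_two, hinner, hinner, hsymm (b 0), hsymm (b 1)] at this
    exact this.symm

/-- With P the matrix with rows (a₀, c₀), (a₁, c₁), the hypotheses read P diag(p,q) Pᵀ = 1. A
one-sided inverse of a square matrix is two-sided, so diag(p,q) Pᵀ P = 1. -/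
theorem gram_transpose {p q a₀ a₁ c₀ c₁ : ℝ} (hp : p ≠ 0)
    (h₀ : p * a₀ ^ 2 + q * c₀ ^ 2 = 1) (h₁ : p * a₁ ^ 2 + q * c₁ ^ 2 = 1)
    (h₂ : p * (a₀ * a₁) + q * (c₀ * c₁) = 0) :
    p * (a₀ ^ 2 + a₁ ^ 2) = 1 ∧ q * (c₀ ^ 2 + c₁ ^ 2) = 1 ∧ a₀ * c₀ + a₁ * c₁ = 0 := by
  have h : !![a₀, c₀; a₁, c₁] * !![p * a₀, p * a₁; q * c₀, q * c₁] = 1 := by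
    ext i j
    fin_cases i <;> fin_cases j <;> simp <;> linarith
  rw [mul_eq_one_comm, Matrix.one_fin_two, Matrix.mul_fin_two] at h
  have e₀ := congrFun₂ h 0 0
  have e₁ := congrFun₂ h 1 1
  have e₂ := congrFun₂ h 0 1
  simp at e₀ e₁ e₂
  refine ⟨by linarith, by linarith, ?_⟩
  have : p * (a₀ * c₀ + a₁ * c₁) = 0 := by linarith
  exact (mul_eq_zero.1 this).resolve_left hp

/-! ### The second fundamental form of a graph -/

section Graph
variable {E' : Type*} [NormedAddCommGroup E'] [NormedSpace ℝ E']
  {H' : Type*} [TopologicalSpace H'] {J : ModelWithCorners ℝ E' H'}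
  {N : Type*} [TopologicalSpace N] [ChartedSpace H' N]
  {E : Type*} [NormedAddCommGroup E] [NormedSpace ℝ E]
  {H : Type*} [TopologicalSpace H] {I : ModelWithCorners ℝ E H}
  {M : Type*} [TopologicalSpace M] [ChartedSpace H M]

/-- The graph of a diffeomorphism, as the embedding `x ↦ (x, φ x)`. -/
def diffeoGraph (φ : M ≃ₘ⟮I, J⟯ N) : M → M × N := fun x ↦ (x, φ x)

theorem mfderiv_diffeoGraph (φ : M ≃ₘ⟮I, J⟯ N) (x : M) (v : TangentSpace I x) :
    mfderiv I (I.prod J) (diffeoGraph φ) x v = (v, mfderiv I J φ x v) := by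
  have h := mfderiv_prodMk (I := I) (I' := I) (I'' := J) (x := x) (f := fun y : M ↦ y)
    (g := φ) mdifferentiableAt_id (φ.mdifferentiable (by simp) x)
  refine (congrArg (fun L ↦ L v) h).trans ?_
  have h' : mfderiv I I (fun y : M ↦ y) x = ContinuousLinearMap.id ℝ _ := mfderiv_id
  rw [h']
  rfl

theorem contMDiff_diffeoGraph (φ : M ≃ₘ⟮I, J⟯ N) :
    ContMDiff I (I.prod J) ∞ (diffeoGraph φ) :=
  contMDiff_id.prodMk φ.contMDiff

theorem isSmoothImmersion_diffeoGraph (φ : M ≃ₘ⟮I, J⟯ N) :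
    IsSmoothImmersion I (I.prod J) (diffeoGraph φ) := by
  refine ⟨contMDiff_diffeoGraph φ, fun x u v h ↦ ?_⟩
  rw [mfderiv_diffeoGraph, mfderiv_diffeoGraph] at h
  exact congrArg Prod.fst h

variable [IsManifold I ∞ M] [IsManifold J ∞ N] [FiniteDimensional ℝ E] [FiniteDimensional ℝ E']

theorem prodMetric_inner_graph (g : SmoothMetric I M) (g' : SmoothMetric J N)
    (φ : M ≃ₘ⟮I, J⟯ N) (x : M) (v : TangentSpace I x)
    (ν : TangentSpace (I.prod J) (diffeoGraph φ x)) :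
    (prodMetric g g').inner (diffeoGraph φ x)
      (mfderiv I (I.prod J) (diffeoGraph φ) x v) ν =
      g.inner x v ν.1 + g'.inner (φ x) (mfderiv I J φ x v) ν.2 := by
  rw [mfderiv_diffeoGraph]
  exact prodMetric_inner_apply g g' (diffeoGraph φ x) _ ν

/-- Modulo tangent vectors of the graph, the derivative of dF(V) along itself is (-D(V,V), 0), so
pairing with a normal vector sees only the first component of the latter. -/
theorem inner_leviCivita_graph [I.Boundaryless] [J.Boundaryless]
    (g : SmoothMetric I M) (g' : SmoothMetric J N)
    (φ : M ≃ₘ⟮I, J⟯ N) {x : M} {V : Π y : M, TangentSpace I y}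
    {W : Π z : M × N, TangentSpace (I.prod J) z}
    (hV : MDiffAt (T% V) x) (hW : MDiffAt (T% W) (diffeoGraph φ x))
    (hVW : ∀ᶠ y in 𝓝 x, mfderiv I (I.prod J) (diffeoGraph φ) y (V y) = W (diffeoGraph φ y))
    {w : TangentSpace I x} {ν : TangentSpace (I.prod J) (diffeoGraph φ x)} (hw : ν.1 = w)
    (hν : ∀ v : TangentSpace I x, (prodMetric g g').inner (diffeoGraph φ x)
      (mfderiv I (I.prod J) (diffeoGraph φ) x v) ν = 0) :
    (prodMetric g g').inner (diffeoGraph φ x)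
      (leviCivita (prodMetric g g') W (diffeoGraph φ x) (W (diffeoGraph φ x))) ν =
      - g.inner x (connectionDiff g g' φ V x (V x)) w := by
  have hpush := mdifferentiableAt_pushField φ hV
  have hprod : MDiffAt (T% (prodField V (pushField φ V))) (diffeoGraph φ x) :=
    mdifferentiableAt_prodField (p := diffeoGraph φ x) hV hpush
  -- `W` is prescribed only along the graph, where it agrees with (V, φ_*V); by
  -- `leviCivita_congr_along` this determines the tangential derivative.
  have heq : ∀ᶠ y in 𝓝 x, W (diffeoGraph φ y) = prodField V (pushField φ V) (diffeoGraph φ y) := by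
    filter_upwards [hVW] with y hy
    rw [← hy, mfderiv_diffeoGraph]
    exact Prod.ext rfl (pushField_apply φ V y).symm
  have h₁ : leviCivita (prodMetric g g') W (diffeoGraph φ x) (W (diffeoGraph φ x)) =
      (leviCivita g V x (V x), mfderiv I J φ x (pullLeviCivita g' φ V x (V x))) := by
    rw [← hVW.self_of_nhds, leviCivita_congr_along _
      ((contMDiff_diffeoGraph φ).contMDiffAt.mdifferentiableAt (by simp)) hW hprod heq,
      leviCivita_prodMetric g g' (p := diffeoGraph φ x) hV hpush, mfderiv_diffeoGraph,
      mfderiv_pullLeviCivita]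
    rfl
  subst hw
  -- Normality against dF((φ^*∇²)_V V) trades the pairing in the second factor for one in the first.
  have h₂ := hν (pullLeviCivita g' φ V x (V x))
  rw [prodMetric_inner_graph] at h₂
  rw [h₁]
  refine (prodMetric_inner_apply g g' (diffeoGraph φ x) _ ν).trans ?_
  change g.inner x (leviCivita g V x (V x)) ν.1 + g'.inner (φ x) (mfderiv I J φ x
    (pullLeviCivita g' φ V x (V x))) ν.2 = _
  have h₃ : ∀ w, g.inner x (connectionDiff g g' φ V x (V x)) w =
      g.inner x (pullLeviCivita g' φ V x (V x)) w - g.inner x (leviCivita g V x (V x)) w := by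
    intro w
    rw [connectionDiff, sub_apply, map_sub, sub_apply]
  linarith [h₃ ν.1]

/-- A vector (w, w') is normal when g'(dφ(v), w') = -g(v, w) for all v. As dφ is invertible and g'
nondegenerate, this determines w' for any w. -/
theorem exists_normal_graph (g : SmoothMetric I M) (g' : SmoothMetric J N)
    (φ : M ≃ₘ⟮I, J⟯ N) (x : M) (w : TangentSpace I x) :
    ∃ ν : TangentSpace (I.prod J) (diffeoGraph φ x), ν.1 = w ∧
      ∀ v : TangentSpace I x, (prodMetric g g').inner (diffeoGraph φ x)
        (mfderiv I (I.prod J) (diffeoGraph φ) x v) ν = 0 := by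
  let e := φ.mfderivToContinuousLinearEquiv (by simp) x
  let L : TangentSpace J (φ x) →L[ℝ] ℝ := - (g.inner x w ∘L e.symm.toContinuousLinearMap)
  refine ⟨(w, (g'.flat (φ x)).symm L), rfl, fun v ↦ ?_⟩
  refine (prodMetric_inner_graph g g' φ x v _).trans ?_
  change g.inner x v w + g'.inner (φ x) (mfderiv I J φ x v) ((g'.flat (φ x)).symm L) = 0
  have h : L (mfderiv I J φ x v) = - g.inner x w v :=
    congrArg (fun z ↦ - g.inner x w z) (e.symm_apply_apply v)
  rw [g'.symm, g'.inner_flat_symm, h, g.symm]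
  ring

/-- The frames V are those orthonormal for the induced metric g + φ^*g'. Any normal first component
occurs, so vanishing of all normal pairings is vanishing of the trace itself. -/
theorem isMinimalImmersion_graph_iff [I.Boundaryless] [J.Boundaryless]
    (g : SmoothMetric I M) (g' : SmoothMetric J N)
    (φ : M ≃ₘ⟮I, J⟯ N) :
    IsMinimalImmersion I (I.prod J) (prodMetric g g') (diffeoGraph φ) ↔
      ∀ (x : M) (V : Fin (Module.finrank ℝ E) → Π y : M, TangentSpace I y),
        (∀ i, CMDiffAt ∞ (T% (V i)) x) →
        (∀ i j, g.inner x (V i x) (V j x) + pullback φ g'.inner x (V i x) (V j x) =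
          if i = j then 1 else 0) →
        ∑ i, connectionDiff g g' φ (V i) x (V i x) = 0 := by
  have key : ∀ (n : ℕ), (∀ (x : M) (V : Fin n → Π y : M, TangentSpace I y)
      (W : Fin n → Π z : M × N, TangentSpace (I.prod J) z),
      (∀ i, CMDiffAt ∞ (T% (V i)) x) → (∀ i, CMDiffAt ∞ (T% (W i)) (diffeoGraph φ x)) →
      (∀ i, ∀ᶠ y in 𝓝 x,
        mfderiv I (I.prod J) (diffeoGraph φ) y (V i y) = W i (diffeoGraph φ y)) →
      (∀ i j, (prodMetric g g').inner (diffeoGraph φ x) (W i (diffeoGraph φ x)) (W j (diffeoGraph φ x)) =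
        if i = j then 1 else 0) →
      ∀ ν : TangentSpace (I.prod J) (diffeoGraph φ x),
        (∀ v : TangentSpace I x, (prodMetric g g').inner (diffeoGraph φ x)
          (mfderiv I (I.prod J) (diffeoGraph φ) x v) ν = 0) →
        ∑ i, (prodMetric g g').inner (diffeoGraph φ x)
          (leviCivita (prodMetric g g') (W i) (diffeoGraph φ x) (W i (diffeoGraph φ x))) ν = 0) ↔
      ∀ (x : M) (V : Fin n → Π y : M, TangentSpace I y), (∀ i, CMDiffAt ∞ (T% (V i)) x) →
        (∀ i j, g.inner x (V i x) (V j x) + pullback φ g'.inner x (V i x) (V j x) =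
          if i = j then 1 else 0) →
        ∑ i, connectionDiff g g' φ (V i) x (V i x) = 0 := by
    intro n
    have hgram : ∀ (x : M) (u v : TangentSpace I x),
        (prodMetric g g').inner (diffeoGraph φ x)
          (mfderiv I (I.prod J) (diffeoGraph φ) x u)
          (mfderiv I (I.prod J) (diffeoGraph φ) x v) =
        g.inner x u v + pullback φ g'.inner x u v := by
      intro x u v
      rw [prodMetric_inner_graph, mfderiv_diffeoGraph]
      rfl
    constructor
    · intro h x V hV hVo
      have hVW : ∀ i, ∀ y, mfderiv I (I.prod J) (diffeoGraph φ) y (V i y) =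
          prodField (V i) (pushField φ (V i)) (diffeoGraph φ y) := by
        intro i y
        rw [mfderiv_diffeoGraph]
        exact Prod.ext rfl (pushField_apply φ (V i) y).symm
      have hW : ∀ i, CMDiffAt ∞ (T% (prodField (V i) (pushField φ (V i)))) (diffeoGraph φ x) :=
        fun i ↦ contMDiffAt_prodField (p := diffeoGraph φ x) (hV i) (contMDiffAt_pushField φ (hV i))
      refine g.ext_inner fun w ↦ ?_
      obtain ⟨ν, hw, hν⟩ := exists_normal_graph g g' φ x w
      have h' := h x V _ hV hW (fun i ↦ .of_forall (hVW i))
        (fun i j ↦ by rw [← hVW, ← hVW, hgram]; exact hVo i j) ν hν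
      rw [Finset.sum_congr rfl fun i _ ↦ inner_leviCivita_graph g g' φ
        ((hV i).mdifferentiableAt (by simp)) ((hW i).mdifferentiableAt (by simp))
        (.of_forall (hVW i)) hw hν, Finset.sum_neg_distrib, neg_eq_zero] at h'
      simpa [map_sum] using h'
    · intro h x V W hV hW hVW hWo ν hν
      have h' := h x V hV fun i j ↦ by
        rw [← hgram, (hVW i).self_of_nhds, (hVW j).self_of_nhds]
        exact hWo i j
      obtain ⟨w, hw⟩ : ∃ w : TangentSpace I x, ν.1 = w := ⟨_, rfl⟩
      rw [Finset.sum_congr rfl fun i _ ↦ inner_leviCivita_graph g g' φ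
        ((hV i).mdifferentiableAt (by simp)) ((hW i).mdifferentiableAt (by simp)) (hVW i)
        hw hν, Finset.sum_neg_distrib, neg_eq_zero]
      simpa [map_sum] using congrArg (fun z ↦ g.inner x z w) h'
  rw [IsMinimalImmersion, and_iff_right (isSmoothImmersion_diffeoGraph φ), key]

end Graph

/-! ### Eigenbases in a tangent plane -/

section Frame
variable {E : Type*} [NormedAddCommGroup E] [NormedSpace ℝ E]
  {H : Type*} [TopologicalSpace H] {I : ModelWithCorners ℝ E H}
  {M : Type*} [TopologicalSpace M] [ChartedSpace H M] [IsManifold I ∞ M]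

/-- `e₁, e₂` is an orthonormal basis of eigenvectors of the endomorphism `T` of the tangent plane
at `x`, with eigenvalues `l` and `m`. -/
structure IsEigenbasis (g : SmoothMetric I M) {x : M} (T : TangentSpace I x →L[ℝ] TangentSpace I x)
    (e₁ e₂ : TangentSpace I x) (l m : ℝ) : Prop where
  unit₁ : g.inner x e₁ e₁ = 1
  unit₂ : g.inner x e₂ e₂ = 1
  orthogonal : g.inner x e₁ e₂ = 0
  apply₁ : T e₁ = l • e₁
  apply₂ : T e₂ = m • e₂
  expand : ∀ v, v = g.inner x v e₁ • e₁ + g.inner x v e₂ • e₂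

theorem exists_isEigenbasis (hdim : Module.finrank ℝ E = 2) (g : SmoothMetric I M) {x : M}
    (T : TangentSpace I x →L[ℝ] TangentSpace I x)
    (hsa : ∀ u v : TangentSpace I x, g.inner x (T u) v = g.inner x u (T v)) :
    ∃ (e₁ e₂ : TangentSpace I x) (l m : ℝ), IsEigenbasis g T e₁ e₂ l m ∧
      LinearMap.det (T : TangentSpace I x →ₗ[ℝ] TangentSpace I x) = l * m := by
  let B : TangentSpace I x →ₗ[ℝ] TangentSpace I x →ₗ[ℝ] ℝ :=
    LinearMap.mk₂ ℝ (fun u v ↦ g.inner x u v) (by simp) (by simp) (by simp) (by simp)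
  obtain ⟨e₁, e₂, l, m, h₁, h₂, h₃, h₄, h₅, h₆, h₇⟩ :=
    exists_orthonormal_eigenbasis_of_finrank_eq_two (V := TangentSpace I x) hdim B
      (fun u v ↦ g.symm x u v) (fun v hv ↦ g.pos x v hv)
      (T : TangentSpace I x →ₗ[ℝ] TangentSpace I x) hsa
  exact ⟨e₁, e₂, l, m, ⟨h₁, h₂, h₃, h₄, h₅, h₇⟩, h₆⟩

namespace IsEigenbasis
variable {g : SmoothMetric I M} {x : M} {T : TangentSpace I x →L[ℝ] TangentSpace I x}
  {e₁ e₂ : TangentSpace I x} {l m : ℝ}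

theorem swap (h : IsEigenbasis g T e₁ e₂ l m) : IsEigenbasis g T e₂ e₁ m l where
  unit₁ := h.unit₂
  unit₂ := h.unit₁
  orthogonal := by rw [g.symm, h.orthogonal]
  apply₁ := h.apply₂
  apply₂ := h.apply₁
  expand v := by rw [add_comm]; exact h.expand v

theorem eigenvalue_pos (h : IsEigenbasis g T e₁ e₂ l m)
    (hpos : ∀ v : TangentSpace I x, v ≠ 0 → 0 < g.inner x (T v) v) : 0 < l := by
  have h0 : e₁ ≠ 0 := by
    rintro rfl
    simpa using h.unit₁
  simpa [h.apply₁, h.unit₁] using hpos e₁ h0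

theorem inner_eq (h : IsEigenbasis g T e₁ e₂ l m) (u v : TangentSpace I x) :
    g.inner x u v = g.inner x u e₁ * g.inner x v e₁ + g.inner x u e₂ * g.inner x v e₂ := by
  conv_lhs => rw [h.expand v]
  simp
  ring

theorem eq_zero (h : IsEigenbasis g T e₁ e₂ l m) {v : TangentSpace I x}
    (h₁ : g.inner x v e₁ = 0) (h₂ : g.inner x v e₂ = 0) : v = 0 := by
  rw [h.expand v, h₁, h₂]
  simp

/-- On a plane an alternating form is determined by its value on one basis; this serves both area
forms and the pulled back symplectic form. -/
theorem alternating_eq (h : IsEigenbasis g T e₁ e₂ l m)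
    {β : TangentSpace I x →L[ℝ] TangentSpace I x →L[ℝ] ℝ} (hβ : ∀ v, β v v = 0)
    (u v : TangentSpace I x) :
    β u v = (g.inner x u e₁ * g.inner x v e₂ - g.inner x u e₂ * g.inner x v e₁) * β e₁ e₂ := by
  have hs : β e₂ e₁ = - β e₁ e₂ := by
    have := hβ (e₁ + e₂)
    simp only [map_add, add_apply, hβ] at this
    linarith
  conv_lhs => rw [h.expand u, h.expand v]
  simp only [map_add, map_smul, add_apply, smul_apply, smul_eq_mul, hβ, hs]
  ring

/-- Gram determinants scale by the squared determinant. This turns det = 1 into an identity between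
functions built from arbitrary fields, which can be differentiated. -/
theorem gram_apply (h : IsEigenbasis g T e₁ e₂ l m)
    (hsa : ∀ u v : TangentSpace I x, g.inner x (T u) v = g.inner x u (T v))
    (u v : TangentSpace I x) :
    g.inner x (T u) (T u) * g.inner x (T v) (T v) - g.inner x (T u) (T v) * g.inner x (T u) (T v) =
      (l * m) ^ 2 * (g.inner x u u * g.inner x v v - g.inner x u v * g.inner x u v) := by
  have h₁ : ∀ w, g.inner x (T w) e₁ = l * g.inner x w e₁ := fun w ↦ by
    rw [hsa, h.apply₁, map_smul, smul_eq_mul]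
  have h₂ : ∀ w, g.inner x (T w) e₂ = m * g.inner x w e₂ := fun w ↦ by
    rw [hsa, h.apply₂, map_smul, smul_eq_mul]
  rw [h.inner_eq (T u) (T u), h.inner_eq (T v) (T v), h.inner_eq (T u) (T v), h.inner_eq u u,
    h.inner_eq v v, h.inner_eq u v]
  simp only [h₁, h₂]
  ring

end IsEigenbasis

variable [FiniteDimensional ℝ E]

theorem mvfderiv_gram (g : SmoothMetric I M) {Y Z : Π x : M, TangentSpace I x} {x : M}
    (hY : MDiffAt (T% Y) x) (hZ : MDiffAt (T% Z) x) (v : TangentSpace I x) :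
    mvfderiv I (g.pair Y Y * g.pair Z Z - g.pair Y Z * g.pair Y Z) x v =
      2 * g.inner x (leviCivita g Y x v) (Y x) * g.inner x (Z x) (Z x)
        + 2 * g.inner x (Y x) (Y x) * g.inner x (leviCivita g Z x v) (Z x)
        - 2 * g.inner x (Y x) (Z x) * (g.inner x (leviCivita g Y x v) (Z x)
          + g.inner x (Y x) (leviCivita g Z x v)) := by
  obtain ⟨X, hX, rfl⟩ := exists_contMDiffAt_field_eq I v
  replace hX := hX.mdifferentiableAt (by simp)
  have hYY := g.mdifferentiableAt_pair hY hY
  have hZZ := g.mdifferentiableAt_pair hZ hZ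
  have hYZ := g.mdifferentiableAt_pair hY hZ
  rw [mvfderiv_sub (hYY.mul hZZ) (hYZ.mul hYZ), mvfderiv_mul hYY hZZ, mvfderiv_mul hYZ hYZ]
  simp only [sub_apply, add_apply, smul_apply, smul_eq_mul, leviCivita_metric g hX hY hY,
    leviCivita_metric g hX hZ hZ, leviCivita_metric g hX hY hZ]
  rw [g.symm x (Y x) (leviCivita g Y x (X x)), g.symm x (Z x) (leviCivita g Z x (X x))]
  simp only [SmoothMetric.pair]
  ring

variable {A : Π x : M, TangentSpace I x →L[ℝ] TangentSpace I x}

/-- The derivative of the equation `det A = 1`. -/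
theorem IsEigenbasis.trace_tensorDeriv_eq_zero (hdim : Module.finrank ℝ E = 2)
    {g : SmoothMetric I M} (hA : IsSmoothEndo A)
    (hsa : ∀ (x : M) (u v : TangentSpace I x), g.inner x (A x u) v = g.inner x u (A x v))
    (hdet : ∀ x : M, LinearMap.det (A x : TangentSpace I x →ₗ[ℝ] TangentSpace I x) = 1)
    {X₁ X₂ : Π x : M, TangentSpace I x} {x : M} {l m : ℝ}
    (h : IsEigenbasis g (A x) (X₁ x) (X₂ x) l m) (hlm : l * m = 1)
    (h₁ : MDiffAt (T% X₁) x) (h₂ : MDiffAt (T% X₂) x) (v : TangentSpace I x) :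
    m * g.inner x (tensorDeriv g A X₁ x v) (X₁ x)
      + l * g.inner x (tensorDeriv g A X₂ x v) (X₂ x) = 0 := by
  -- `X₁`, `X₂` are eigenvectors only at `x`, since eigenvectors need not extend smoothly where the
  -- eigenvalues meet. The Gram identity is instead proved at each `y` with an eigenbasis there.
  have hgram : g.pair (fun y ↦ A y (X₁ y)) (fun y ↦ A y (X₁ y))
        * g.pair (fun y ↦ A y (X₂ y)) (fun y ↦ A y (X₂ y))
        - g.pair (fun y ↦ A y (X₁ y)) (fun y ↦ A y (X₂ y))
          * g.pair (fun y ↦ A y (X₁ y)) (fun y ↦ A y (X₂ y)) =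
      g.pair X₁ X₁ * g.pair X₂ X₂ - g.pair X₁ X₂ * g.pair X₁ X₂ := by
    funext y
    obtain ⟨e₁, e₂, l', m', h', hd⟩ := exists_isEigenbasis hdim g (A y) (hsa y)
    have := h'.gram_apply (hsa y) (X₁ y) (X₂ y)
    rwa [← hd, hdet, one_pow, one_mul] at this
  have hL := mvfderiv_gram g (hA.mdifferentiableAt_apply h₁) (hA.mdifferentiableAt_apply h₂) v
  rw [hgram, mvfderiv_gram g h₁ h₂ v] at hL
  simp only [leviCivita_tensor_apply, h.apply₁, h.apply₂, map_smul, map_add, add_apply,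
    smul_apply, smul_eq_mul, h.unit₁, h.unit₂, h.orthogonal, hsa] at hL
  -- The terms in ∇X₁ and ∇X₂ carry the factor 1 on one side and (lm)² on the other, so they cancel,
  -- leaving the derivatives of `A`.
  linear_combination (-1 / 2) * hL - (m * g.inner x (tensorDeriv g A X₁ x v) (X₁ x)
    + l * g.inner x (tensorDeriv g A X₂ x v) (X₂ x)
    + (l * m + 1) * (g.inner x (leviCivita g X₁ x v) (X₁ x)
      + g.inner x (leviCivita g X₂ x v) (X₂ x))) * hlm

/-- The exterior derivative of a self-adjoint tensor is determined by its value on a frame. -/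
theorem IsEigenbasis.extDerivTensor_eq {g : SmoothMetric I M} (hA : IsSmoothEndo A)
    (hsa : ∀ (x : M) (u v : TangentSpace I x), g.inner x (A x u) v = g.inner x u (A x v))
    {X₁ X₂ X Y : Π x : M, TangentSpace I x} {x : M} {l m : ℝ}
    (h : IsEigenbasis g (A x) (X₁ x) (X₂ x) l m)
    (h₁ : MDiffAt (T% X₁) x) (h₂ : MDiffAt (T% X₂) x)
    (hX : MDiffAt (T% X) x) (hY : MDiffAt (T% Y) x) :
    extDerivTensor g A X Y x =
      (g.inner x (X x) (X₁ x) * g.inner x (Y x) (X₂ x)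
        - g.inner x (X x) (X₂ x) * g.inner x (Y x) (X₁ x)) • extDerivTensor g A X₁ X₂ x := by
  have key : ∀ {Z : Π x : M, TangentSpace I x}, MDiffAt (T% Z) x → ∀ v, tensorDeriv g A Z x v =
      g.inner x (Z x) (X₁ x) • tensorDeriv g A X₁ x v
        + g.inner x (Z x) (X₂ x) • tensorDeriv g A X₂ x v := by
    intro Z hZ v
    refine g.ext_inner fun w ↦ ?_
    obtain ⟨W, hW, rfl⟩ := exists_contMDiffAt_field_eq I w
    replace hW := hW.mdifferentiableAt (by simp)
    -- Self-adjointness of ∇_v A moves `Z` to the slot where only its value at `x` counts, so it can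
    -- be expanded in the eigenbasis.
    rw [inner_tensorDeriv_comm g hA hsa hZ hW]
    conv_lhs => rw [h.expand (Z x)]
    simp only [map_add, map_smul, add_apply, smul_apply, smul_eq_mul]
    rw [inner_tensorDeriv_comm g hA hsa h₁ hW, inner_tensorDeriv_comm g hA hsa h₂ hW]
  rw [extDerivTensor_eq_tensorDeriv g A hX hY, extDerivTensor_eq_tensorDeriv g A h₁ h₂,
    key hY, key hX]
  obtain ⟨a, ha⟩ : ∃ a, g.inner x (X x) (X₁ x) = a := ⟨_, rfl⟩
  obtain ⟨a', ha'⟩ : ∃ a, g.inner x (X x) (X₂ x) = a := ⟨_, rfl⟩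
  obtain ⟨c, hc⟩ : ∃ a, g.inner x (Y x) (X₁ x) = a := ⟨_, rfl⟩
  obtain ⟨c', hc'⟩ : ∃ a, g.inner x (Y x) (X₂ x) = a := ⟨_, rfl⟩
  have eX := h.expand (X x)
  have eY := h.expand (Y x)
  rw [ha, ha'] at eX
  rw [hc, hc'] at eY
  rw [ha, ha', hc, hc', eX, eY]
  simp only [map_add, map_smul]
  module

/-! ### The trace of the difference of the connections and the Codazzi equation -/

section Difference
variable {E' : Type*} [NormedAddCommGroup E'] [NormedSpace ℝ E'] [FiniteDimensional ℝ E']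
  {H' : Type*} [TopologicalSpace H'] {J : ModelWithCorners ℝ E' H'}
  {N : Type*} [TopologicalSpace N] [ChartedSpace H' N] [IsManifold J ∞ N]
  {g₁ : SmoothMetric I M} {g₂ : SmoothMetric J N} {φ : M ≃ₘ⟮I, J⟯ N}

/-- The comparison of connections is used for the triples (X₁; X₁, X₁), (X₂; X₂, X₁) and (X₁; X₂,
X₂), the direction coming first. The symmetry of D eliminates the mixed term, and the derivative of
det A = 1 removes ∇_{X₁}A on X₁. -/
theorem IsEigenbasis.inner_trace_connectionDiff (hdim : Module.finrank ℝ E = 2)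
    (hA : IsSmoothEndo A)
    (hsa : ∀ (x : M) (u v : TangentSpace I x), g₁.inner x (A x u) v = g₁.inner x u (A x v))
    (hdet : ∀ x : M, LinearMap.det (A x : TangentSpace I x →ₗ[ℝ] TangentSpace I x) = 1)
    (hpull : ∀ (x : M) (u v : TangentSpace I x),
      pullback φ g₂.inner x u v = g₁.inner x (A x u) (A x v))
    {X₁ X₂ : Π x : M, TangentSpace I x} {x : M} {l m : ℝ}
    (h : IsEigenbasis g₁ (A x) (X₁ x) (X₂ x) l m) (hlm : l * m = 1)
    (h₁ : MDiffAt (T% X₁) x) (h₂ : MDiffAt (T% X₂) x) :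
    g₁.inner x (connectionDiff g₁ g₂ φ X₁ x (X₁ x)
        + l ^ 2 • connectionDiff g₁ g₂ φ X₂ x (X₂ x)) (X₁ x) =
      - (l + m) * g₁.inner x (extDerivTensor g₁ A X₁ X₂ x) (X₂ x) := by
  have hd := h.trace_tensorDeriv_eq_zero hdim hA hsa hdet hlm h₁ h₂ (X₁ x)
  have c₁ := inner_connectionDiff_add g₁ g₂ φ hA hpull h₁ h₁ (X₁ x)
  have c₂ := inner_connectionDiff_add g₁ g₂ φ hA hpull h₂ h₁ (X₂ x)
  have c₃ := inner_connectionDiff_add g₁ g₂ φ hA hpull h₂ h₂ (X₁ x)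
  have s₁ := inner_tensorDeriv_comm g₁ hA hsa h₁ h₂ (X₂ x)
  rw [extDerivTensor_eq_tensorDeriv g₁ A h₁ h₂]
  rw [connectionDiff_comm g₁ g₂ φ h₂ h₁] at c₂
  have a₁ : ∀ u, g₁.inner x u (A x (X₁ x)) = l * g₁.inner x u (X₁ x) := fun u ↦ by
    rw [h.apply₁, map_smul, smul_eq_mul]
  have a₂ : ∀ u, g₁.inner x u (A x (X₂ x)) = m * g₁.inner x u (X₂ x) := fun u ↦ by
    rw [h.apply₂, map_smul, smul_eq_mul]
  simp only [a₁, a₂, hsa, g₁.symm x (X₁ x), g₁.symm x (X₂ x)] at c₁ c₂ c₃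
  simp only [map_add, map_sub, map_smul, add_apply, sub_apply, smul_apply, smul_eq_mul]
  have t₁ : g₁.inner x (connectionDiff g₁ g₂ φ X₁ x (X₁ x)) (X₁ x) =
      m * g₁.inner x (tensorDeriv g₁ A X₁ x (X₁ x)) (X₁ x) := by
    linear_combination (m ^ 2 / 2) * c₁ + (m * g₁.inner x (tensorDeriv g₁ A X₁ x (X₁ x)) (X₁ x)
      - (l * m + 1) * g₁.inner x (connectionDiff g₁ g₂ φ X₁ x (X₁ x)) (X₁ x)) * hlm
  linear_combination t₁ + c₂ - c₃ / 2 + hd - l * s₁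

/-- The trace of the difference of the two connections, for the metric `g₁ + φ^*g₂`, vanishes exactly
when the exterior derivative of `A` does. -/
theorem IsEigenbasis.trace_connectionDiff_eq_zero_iff (hdim : Module.finrank ℝ E = 2)
    (hA : IsSmoothEndo A)
    (hsa : ∀ (x : M) (u v : TangentSpace I x), g₁.inner x (A x u) v = g₁.inner x u (A x v))
    (hpos : ∀ (x : M) (v : TangentSpace I x), v ≠ 0 → 0 < g₁.inner x (A x v) v)
    (hdet : ∀ x : M, LinearMap.det (A x : TangentSpace I x →ₗ[ℝ] TangentSpace I x) = 1)
    (hpull : ∀ (x : M) (u v : TangentSpace I x),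
      pullback φ g₂.inner x u v = g₁.inner x (A x u) (A x v))
    {X₁ X₂ : Π x : M, TangentSpace I x} {x : M} {l m : ℝ}
    (h : IsEigenbasis g₁ (A x) (X₁ x) (X₂ x) l m) (hlm : l * m = 1)
    (h₁ : MDiffAt (T% X₁) x) (h₂ : MDiffAt (T% X₂) x) :
    connectionDiff g₁ g₂ φ X₁ x (X₁ x) + l ^ 2 • connectionDiff g₁ g₂ φ X₂ x (X₂ x) = 0 ↔
      extDerivTensor g₁ A X₁ X₂ x = 0 := by
  have hl := h.eigenvalue_pos (hpos x)
  have hm := h.swap.eigenvalue_pos (hpos x)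
  have k₁ := h.inner_trace_connectionDiff hdim hA hsa hdet hpull hlm h₁ h₂
  have k₂ := h.swap.inner_trace_connectionDiff hdim hA hsa hdet hpull (by rw [mul_comm, hlm]) h₂ h₁
  have hsw : extDerivTensor g₁ A X₂ X₁ x = - extDerivTensor g₁ A X₁ X₂ x := by
    rw [extDerivTensor_eq_tensorDeriv g₁ A h₁ h₂, extDerivTensor_eq_tensorDeriv g₁ A h₂ h₁, neg_sub]
  -- Exchanging the eigenvectors multiplies the trace by m², because lm = 1; the exchanged identity
  -- thus gives its second component.
  have hsm : connectionDiff g₁ g₂ φ X₂ x (X₂ x) + m ^ 2 • connectionDiff g₁ g₂ φ X₁ x (X₁ x) =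
      m ^ 2 • (connectionDiff g₁ g₂ φ X₁ x (X₁ x)
        + l ^ 2 • connectionDiff g₁ g₂ φ X₂ x (X₂ x)) := by
    rw [smul_add, smul_smul, ← mul_pow, mul_comm m l, hlm, one_pow, one_smul, add_comm]
  rw [hsw, hsm] at k₂
  simp only [map_smul, map_neg, neg_apply, smul_apply, smul_eq_mul] at k₂
  constructor
  · intro h0
    rw [h0] at k₁ k₂
    simp only [map_zero, zero_apply, mul_zero] at k₁ k₂
    refine h.eq_zero ?_ ?_
    · have : (m + l) * g₁.inner x (extDerivTensor g₁ A X₁ X₂ x) (X₁ x) = 0 := by linarith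
      exact (mul_eq_zero.1 this).resolve_left (by positivity)
    · have : (l + m) * g₁.inner x (extDerivTensor g₁ A X₁ X₂ x) (X₂ x) = 0 := by linarith
      exact (mul_eq_zero.1 this).resolve_left (by positivity)
  · intro h0
    rw [h0] at k₁ k₂
    simp only [map_zero, zero_apply, mul_zero, neg_zero] at k₁ k₂
    exact h.eq_zero k₁ ((mul_eq_zero.1 k₂).resolve_left (by positivity))

/-- The trace over an orthonormal frame for `g₁ + φ^*g₂`, computed in an eigenbasis of `A`. -/
theorem IsEigenbasis.sum_connectionDiff
    (hsa : ∀ (x : M) (u v : TangentSpace I x), g₁.inner x (A x u) v = g₁.inner x u (A x v))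
    (hpull : ∀ (x : M) (u v : TangentSpace I x),
      pullback φ g₂.inner x u v = g₁.inner x (A x u) (A x v))
    {X₁ X₂ : Π x : M, TangentSpace I x} {x : M} {l m : ℝ}
    (h : IsEigenbasis g₁ (A x) (X₁ x) (X₂ x) l m) (hlm : l * m = 1)
    (h₁ : MDiffAt (T% X₁) x) (h₂ : MDiffAt (T% X₂) x)
    {V : Fin 2 → Π y : M, TangentSpace I y} (hV : ∀ i, MDiffAt (T% (V i)) x)
    (hVo : ∀ i j, g₁.inner x (V i x) (V j x) + pullback φ g₂.inner x (V i x) (V j x) =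
      if i = j then 1 else 0) :
    (1 + l ^ 2) • ∑ i, connectionDiff g₁ g₂ φ (V i) x (V i x) =
      connectionDiff g₁ g₂ φ X₁ x (X₁ x) + l ^ 2 • connectionDiff g₁ g₂ φ X₂ x (X₂ x) := by
  have hG : ∀ u v : TangentSpace I x, g₁.inner x u v + pullback φ g₂.inner x u v =
      (1 + l ^ 2) * (g₁.inner x u (X₁ x) * g₁.inner x v (X₁ x))
        + (1 + m ^ 2) * (g₁.inner x u (X₂ x) * g₁.inner x v (X₂ x)) := by
    intro u v
    rw [hpull, h.inner_eq u v, h.inner_eq (A x u) (A x v)]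
    simp only [hsa, h.apply₁, h.apply₂, map_smul, smul_eq_mul]
    ring
  have hT : ∀ i, connectionDiff g₁ g₂ φ (V i) x (V i x) =
      g₁.inner x (V i x) (X₁ x) ^ 2 • connectionDiff g₁ g₂ φ X₁ x (X₁ x)
      + (g₁.inner x (V i x) (X₁ x) * g₁.inner x (V i x) (X₂ x)) •
        (2 • connectionDiff g₁ g₂ φ X₁ x (X₂ x))
      + g₁.inner x (V i x) (X₂ x) ^ 2 • connectionDiff g₁ g₂ φ X₂ x (X₂ x) := by
    intro i
    obtain ⟨a, ha⟩ : ∃ a, g₁.inner x (V i x) (X₁ x) = a := ⟨_, rfl⟩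
    obtain ⟨c, hc⟩ : ∃ a, g₁.inner x (V i x) (X₂ x) = a := ⟨_, rfl⟩
    have e := h.expand (V i x)
    rw [ha, hc] at e
    rw [ha, hc]
    conv_lhs => rw [e]
    -- By symmetry the field `V i` enters only through its value at `x`, which is expanded once
    -- more.
    rw [map_add, map_smul, map_smul, connectionDiff_comm g₁ g₂ φ h₁ (hV i),
      connectionDiff_comm g₁ g₂ φ h₂ (hV i), e]
    simp only [map_add, map_smul]
    rw [connectionDiff_comm g₁ g₂ φ h₁ h₂]
    module
  have o₀ := hVo 0 0
  have o₁ := hVo 1 1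
  have o₂ := hVo 0 1
  rw [hG, if_pos rfl] at o₀ o₁
  rw [hG, if_neg (by simp)] at o₂
  -- Orthonormality of V for diag(1 + l², 1 + m²) is transposed into sums over the frame index, the
  -- coefficients of the trace.
  obtain ⟨r₁, r₂, r₃⟩ := gram_transpose (p := 1 + l ^ 2) (q := 1 + m ^ 2) (by positivity)
    (by linear_combination o₀) (by linear_combination o₁) o₂
  -- Since lm = 1, 1 + l² = l² (1 + m²).
  have r₄ : (1 + l ^ 2) * (g₁.inner x (V 0 x) (X₂ x) ^ 2 + g₁.inner x (V 1 x) (X₂ x) ^ 2)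
      = l ^ 2 := by
    linear_combination l ^ 2 * r₂ - (l * m + 1)
      * (g₁.inner x (V 0 x) (X₂ x) ^ 2 + g₁.inner x (V 1 x) (X₂ x) ^ 2) * hlm
  rw [Fin.sum_univ_two, hT 0, hT 1]
  calc _ = ((1 + l ^ 2) * (g₁.inner x (V 0 x) (X₁ x) ^ 2 + g₁.inner x (V 1 x) (X₁ x) ^ 2)) •
          connectionDiff g₁ g₂ φ X₁ x (X₁ x)
        + ((1 + l ^ 2) * (g₁.inner x (V 0 x) (X₁ x) * g₁.inner x (V 0 x) (X₂ x)
          + g₁.inner x (V 1 x) (X₁ x) * g₁.inner x (V 1 x) (X₂ x))) •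
            (2 • connectionDiff g₁ g₂ φ X₁ x (X₂ x))
        + ((1 + l ^ 2) * (g₁.inner x (V 0 x) (X₂ x) ^ 2 + g₁.inner x (V 1 x) (X₂ x) ^ 2)) •
          connectionDiff g₁ g₂ φ X₂ x (X₂ x) := by module
    _ = _ := by rw [r₁, r₃, r₄]; simp

/-- For `φ^*g₂ = g₁(A·, A·)` with `det A = 1`, the trace of the difference of the connections
vanishes if and only if `A` is a Codazzi tensor. -/
theorem sum_connectionDiff_eq_zero_iff_isCodazzi (hdim : Module.finrank ℝ E = 2)
    (hA : IsSmoothEndo A)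
    (hsa : ∀ (x : M) (u v : TangentSpace I x), g₁.inner x (A x u) v = g₁.inner x u (A x v))
    (hpos : ∀ (x : M) (v : TangentSpace I x), v ≠ 0 → 0 < g₁.inner x (A x v) v)
    (hdet : ∀ x : M, LinearMap.det (A x : TangentSpace I x →ₗ[ℝ] TangentSpace I x) = 1)
    (hpull : ∀ (x : M) (u v : TangentSpace I x),
      pullback φ g₂.inner x u v = g₁.inner x (A x u) (A x v)) :
    (∀ (x : M) (V : Fin 2 → Π y : M, TangentSpace I y), (∀ i, CMDiffAt ∞ (T% (V i)) x) →
        (∀ i j, g₁.inner x (V i x) (V j x) + pullback φ g₂.inner x (V i x) (V j x) =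
          if i = j then 1 else 0) →
        ∑ i, connectionDiff g₁ g₂ φ (V i) x (V i x) = 0) ↔ IsCodazzi g₁ A := by
  have frame : ∀ x : M, ∃ (X₁ X₂ : Π x : M, TangentSpace I x) (l m : ℝ),
      CMDiffAt ∞ (T% X₁) x ∧ CMDiffAt ∞ (T% X₂) x ∧
      IsEigenbasis g₁ (A x) (X₁ x) (X₂ x) l m ∧ l * m = 1 := by
    intro x
    obtain ⟨e₁, e₂, l, m, h, hd⟩ := exists_isEigenbasis hdim g₁ (A x) (hsa x)
    obtain ⟨X₁, hX₁, rfl⟩ := exists_contMDiffAt_field_eq I e₁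
    obtain ⟨X₂, hX₂, rfl⟩ := exists_contMDiffAt_field_eq I e₂
    exact ⟨X₁, X₂, l, m, hX₁, hX₂, h, by rw [← hd, hdet]⟩
  constructor
  · intro hsum x X Y hX hY
    obtain ⟨X₁, X₂, l, m, h₁, h₂, h, hlm⟩ := frame x
    replace h₁ := h₁.mdifferentiableAt (by simp)
    replace h₂ := h₂.mdifferentiableAt (by simp)
    rw [h.extDerivTensor_eq hA hsa h₁ h₂ (hX.mdifferentiableAt (by simp))
      (hY.mdifferentiableAt (by simp))]
    have hl : (0 : ℝ) < 1 + l ^ 2 := by positivity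
    have hm : (0 : ℝ) < 1 + m ^ 2 := by positivity
    -- The eigenvectors have squared lengths 1 + l² and 1 + m² for g₁ + φ^*g₂ and stay orthogonal,
    -- so rescaling gives an admissible frame.
    obtain ⟨V₀, hV₀, e₀⟩ := exists_contMDiffAt_field_eq I ((√(1 + l ^ 2))⁻¹ • X₁ x)
    obtain ⟨V₁, hV₁, e₁⟩ := exists_contMDiffAt_field_eq I ((√(1 + m ^ 2))⁻¹ • X₂ x)
    have hV : ∀ i, CMDiffAt ∞ (T% (![V₀, V₁] i)) x := by
      intro i
      fin_cases i
      · exact hV₀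
      · exact hV₁
    have sl : (√(1 + l ^ 2))⁻¹ * (√(1 + l ^ 2))⁻¹ * (1 + l ^ 2) = 1 := by
      rw [← mul_inv, Real.mul_self_sqrt hl.le, inv_mul_cancel₀ hl.ne']
    have sm : (√(1 + m ^ 2))⁻¹ * (√(1 + m ^ 2))⁻¹ * (1 + m ^ 2) = 1 := by
      rw [← mul_inv, Real.mul_self_sqrt hm.le, inv_mul_cancel₀ hm.ne']
    have hVo : ∀ i j, g₁.inner x (![V₀, V₁] i x) (![V₀, V₁] j x)
        + pullback φ g₂.inner x (![V₀, V₁] i x) (![V₀, V₁] j x) = if i = j then 1 else 0 := by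
      intro i j
      have o := h.swap.orthogonal
      fin_cases i <;> fin_cases j <;>
        simp [e₀, e₁, hpull, h.apply₁, h.apply₂, h.unit₁, h.unit₂, h.orthogonal, o]
      · linear_combination sl
      · linear_combination sm
    have hs := h.sum_connectionDiff hsa hpull hlm h₁ h₂
      (fun i ↦ (hV i).mdifferentiableAt (by simp)) hVo
    rw [hsum x ![V₀, V₁] hV hVo, smul_zero, eq_comm,
      h.trace_connectionDiff_eq_zero_iff hdim hA hsa hpos hdet hpull hlm h₁ h₂] at hs
    rw [hs, smul_zero]
  · intro hc x V hV hVo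
    obtain ⟨X₁, X₂, l, m, h₁, h₂, h, hlm⟩ := frame x
    have h0 := hc x X₁ X₂ h₁ h₂
    replace h₁ := h₁.mdifferentiableAt (by simp)
    replace h₂ := h₂.mdifferentiableAt (by simp)
    rw [← h.trace_connectionDiff_eq_zero_iff (g₂ := g₂) (φ := φ) hdim hA hsa hpos hdet hpull hlm
      h₁ h₂, ← h.sum_connectionDiff hsa hpull hlm h₁ h₂
      (fun i ↦ (hV i).mdifferentiableAt (by simp)) hVo] at h0
    exact (smul_eq_zero.1 h0).resolve_left (by positivity)

end Difference
end Frame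

/-! ### Area forms and the Lagrangian condition -/

section Lagrangian
variable {S : Type*} [TopologicalSpace S] [ChartedSpace (EuclideanSpace ℝ (Fin 2)) S]
  {S' : Type*} [TopologicalSpace S'] [ChartedSpace (EuclideanSpace ℝ (Fin 2)) S']

theorem pullback_graphMap_prodSymplectic (dA : BilinField (𝓡 2) S) (dA' : BilinField (𝓡 2) S')
    (φ : S ≃ₘ⟮𝓡 2, 𝓡 2⟯ S') (x : S) :
    pullback (I := 𝓡 2) (graphMap φ) (prodSymplectic dA dA') x = dA x - pullback φ dA' x := by
  ext u v
  rw [pullback_apply]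
  have h : ∀ w, mfderiv (𝓡 2) ((𝓡 2).prod (𝓡 2)) (graphMap φ) x w =
    (w, mfderiv (𝓡 2) (𝓡 2) φ x w) := mfderiv_diffeoGraph φ x
  rw [h, h]
  exact congrArg₂ (· - ·) (pullback_fst_apply dA (graphMap φ x) _ _)
    (pullback_snd_apply dA' (graphMap φ x) _ _)

variable [IsManifold (𝓡 2) ∞ S'] [IsManifold (𝓡 2) ∞ S]

/-- The area distortion of `φ` is the determinant of `b`. -/
theorem areaForm_eigenbasis {g : SmoothMetric (𝓡 2) S} {g' : SmoothMetric (𝓡 2) S'}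
    {dA : BilinField (𝓡 2) S} {dA' : BilinField (𝓡 2) S'}
    (hdA : IsAreaForm g dA) (hdA' : IsAreaForm g' dA') {φ : S ≃ₘ⟮𝓡 2, 𝓡 2⟯ S'}
    (hφ : IsOrientationPreserving dA dA' φ) {x : S}
    {T : TangentSpace (𝓡 2) x →L[ℝ] TangentSpace (𝓡 2) x}
    (hpull : ∀ u v : TangentSpace (𝓡 2) x,
      pullback φ g'.inner x u v = g.inner x (T u) (T v))
    {e₁ e₂ : TangentSpace (𝓡 2) x} {l m : ℝ} (h : IsEigenbasis g T e₁ e₂ l m)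
    (hl : 0 < l) (hm : 0 < m) :
    (dA x e₁ e₂ = 1 ∧ pullback φ dA' x e₁ e₂ = l * m) ∨
      (dA x e₁ e₂ = -1 ∧ pullback φ dA' x e₁ e₂ = -(l * m)) := by
  have ha := hdA.orthonormal x e₁ e₂ h.unit₁ h.unit₂ h.orthogonal
  -- As φ^*g' = g(T·, T·), dφ sends l⁻¹e₁, m⁻¹e₂ to a g'-orthonormal pair.
  have ha' : |pullback φ dA' x (l⁻¹ • e₁) (m⁻¹ • e₂)| = 1 := by
    refine hdA'.orthonormal (φ x) (mfderiv (𝓡 2) (𝓡 2) φ x (l⁻¹ • e₁))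
      (mfderiv (𝓡 2) (𝓡 2) φ x (m⁻¹ • e₂)) ?_ ?_ ?_
    · refine (hpull _ _).trans ?_
      simp [h.apply₁, h.unit₁, hl.ne']
    · refine (hpull _ _).trans ?_
      simp [h.apply₂, h.unit₂, hm.ne']
    · refine (hpull _ _).trans ?_
      simp [h.apply₁, h.apply₂, h.orthogonal]
  simp only [map_smul, smul_apply, smul_eq_mul, abs_mul, abs_inv, abs_of_pos hl,
    abs_of_pos hm] at ha'
  have ha'' : |pullback φ dA' x e₁ e₂| = l * m := by
    field_simp at ha'
    linarith
  have hs : dA x e₂ e₁ = - dA x e₁ e₂ := by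
    rw [h.alternating_eq (hdA.alternating x) e₂ e₁]
    simp [h.unit₁, h.unit₂, h.orthogonal, h.swap.orthogonal]
  have hs' : pullback φ dA' x e₂ e₁ = - pullback φ dA' x e₁ e₂ := by
    rw [h.alternating_eq (β := pullback φ dA' x) (fun v ↦ hdA'.alternating (φ x) _) e₂ e₁]
    simp [h.unit₁, h.unit₂, h.orthogonal, h.swap.orthogonal]
  -- The eigenbasis need not be positively oriented; in the negative case the orientation hypothesis
  -- applies to (e₂, e₁).
  rcases (abs_eq zero_le_one).1 ha with h1 | h1
  · have := hφ x e₁ e₂ (by rw [h1]; exact one_pos)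
    rw [abs_of_pos this] at ha''
    exact Or.inl ⟨h1, ha''⟩
  · have := hφ x e₂ e₁ (by rw [hs, h1]; simp)
    rw [hs'] at this
    rw [abs_of_neg (by linarith)] at ha''
    exact Or.inr ⟨h1, by linarith⟩

theorem isLagrangianImmersion_graphMap_iff {g : SmoothMetric (𝓡 2) S}
    {g' : SmoothMetric (𝓡 2) S'} {dA : BilinField (𝓡 2) S} {dA' : BilinField (𝓡 2) S'}
    (hdA : IsAreaForm g dA) (hdA' : IsAreaForm g' dA') {φ : S ≃ₘ⟮𝓡 2, 𝓡 2⟯ S'}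
    (hφ : IsOrientationPreserving dA dA' φ)
    {b : Π x : S, TangentSpace (𝓡 2) x →L[ℝ] TangentSpace (𝓡 2) x}
    (hsa : ∀ (x : S) (u v : TangentSpace (𝓡 2) x), g.inner x (b x u) v = g.inner x u (b x v))
    (hpos : ∀ (x : S) (v : TangentSpace (𝓡 2) x), v ≠ 0 → 0 < g.inner x (b x v) v)
    (hpull : ∀ (x : S) (u v : TangentSpace (𝓡 2) x),
      pullback φ g'.inner x u v = g.inner x (b x u) (b x v)) :
    IsLagrangianImmersion (𝓡 2) ((𝓡 2).prod (𝓡 2)) (prodSymplectic dA dA') (graphMap φ) ↔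
      ∀ x : S, LinearMap.det (b x : TangentSpace (𝓡 2) x →ₗ[ℝ] TangentSpace (𝓡 2) x) = 1 := by
  have himm : IsSmoothImmersion (𝓡 2) ((𝓡 2).prod (𝓡 2)) (graphMap φ) :=
    isSmoothImmersion_diffeoGraph φ
  have hrank : 2 * Module.finrank ℝ (EuclideanSpace ℝ (Fin 2)) =
      Module.finrank ℝ (EuclideanSpace ℝ (Fin 2) × EuclideanSpace ℝ (Fin 2)) := by
    simp
  rw [IsLagrangianImmersion, and_iff_right himm, and_iff_right hrank, funext_iff]
  refine forall_congr' fun x ↦ ?_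
  rw [pullback_graphMap_prodSymplectic]
  obtain ⟨e₁, e₂, l, m, h, hd⟩ := exists_isEigenbasis finrank_euclideanSpace_fin g (b x) (hsa x)
  have hl := h.eigenvalue_pos (hpos x)
  have hm := h.swap.eigenvalue_pos (hpos x)
  have key := areaForm_eigenbasis hdA hdA' hφ (hpull x) h hl hm
  have hβ : ∀ u v, (dA x - pullback φ dA' x : TangentSpace (𝓡 2) x →L[ℝ]
      TangentSpace (𝓡 2) x →L[ℝ] ℝ) u v = dA x u v - pullback φ dA' x u v := fun _ _ ↦ rfl
  generalize (dA x - pullback φ dA' x : TangentSpace (𝓡 2) x →L[ℝ]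
    TangentSpace (𝓡 2) x →L[ℝ] ℝ) = β at hβ ⊢
  have halt : ∀ v, β v v = 0 := fun v ↦ by
    rw [hβ, hdA.alternating, pullback_apply, hdA'.alternating, sub_zero]
  have hval : β e₁ e₂ = 0 ↔ l * m = 1 := by
    rw [hβ]
    rcases key with ⟨h₁, h₂⟩ | ⟨h₁, h₂⟩ <;> rw [h₁, h₂] <;> constructor <;> intro <;> linarith
  rw [hd, ← hval]
  constructor
  · intro h0
    rw [h0]
    rfl
  · intro h0
    ext u v
    rw [h.alternating_eq halt u v, h0, mul_zero]
    rfl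

end Lagrangian

end MinLag

end

theorem propositionA1
    {U₁ : Type*} [TopologicalSpace U₁] [T2Space U₁] [SecondCountableTopology U₁]
    [ChartedSpace (EuclideanSpace ℝ (Fin 2)) U₁] [IsManifold (𝓡 2) ∞ U₁]
    {U₂ : Type*} [TopologicalSpace U₂] [T2Space U₂] [SecondCountableTopology U₂]
    [ChartedSpace (EuclideanSpace ℝ (Fin 2)) U₂] [IsManifold (𝓡 2) ∞ U₂]
    (g₁ : MinLag.SmoothMetric (𝓡 2) U₁) (g₂ : MinLag.SmoothMetric (𝓡 2) U₂)
    (hg₁ : MinLag.IsSpherical g₁) (hg₂ : MinLag.IsSpherical g₂)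
    (dA₁ : MinLag.BilinField (𝓡 2) U₁) (dA₂ : MinLag.BilinField (𝓡 2) U₂)
    (hdA₁ : MinLag.IsAreaForm g₁ dA₁) (hdA₂ : MinLag.IsAreaForm g₂ dA₂)
    (φ : U₁ ≃ₘ⟮𝓡 2, 𝓡 2⟯ U₂) (hφ : MinLag.IsOrientationPreserving dA₁ dA₂ φ)
    (b : Π x : U₁, TangentSpace (𝓡 2) x →L[ℝ] TangentSpace (𝓡 2) x)
    (hb_smooth : MinLag.IsSmoothEndo b)
    (hb_selfAdjoint : ∀ (x : U₁) (u v : TangentSpace (𝓡 2) x),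
      g₁.inner x (b x u) v = g₁.inner x u (b x v))
    (hb_pos : ∀ (x : U₁) (v : TangentSpace (𝓡 2) x), v ≠ 0 → 0 < g₁.inner x (b x v) v)
    (hb_pullback : ∀ (x : U₁) (u v : TangentSpace (𝓡 2) x),
      MinLag.pullback φ g₂.inner x u v = g₁.inner x (b x u) (b x v)) :
    MinLag.GraphIsMinimalLagrangian g₁ g₂ dA₁ dA₂ φ ↔
      MinLag.IsCodazzi g₁ b ∧
        ∀ x : U₁, LinearMap.det (b x : TangentSpace (𝓡 2) x →ₗ[ℝ] TangentSpace (𝓡 2) x) = 1 := by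
  rw [MinLag.GraphIsMinimalLagrangian,
    MinLag.isLagrangianImmersion_graphMap_iff hdA₁ hdA₂ hφ hb_selfAdjoint hb_pos hb_pullback]
  -- The Lagrangian condition is already det b = 1, so minimality and the Codazzi equation are
  -- compared only under it.
  refine and_congr_left fun hdet ↦ ?_
  have hdim : Module.finrank ℝ (EuclideanSpace ℝ (Fin 2)) = 2 := finrank_euclideanSpace_fin
  have hmin := MinLag.isMinimalImmersion_graph_iff g₁ g₂ φ
  rw [hdim] at hmin
  -- `graphMap φ` and `diffeoGraph φ` unfold to the same map.
  exact hmin.trans (MinLag.sum_connectionDiff_eq_zero_iff_isCodazzi hdim hb_smooth hb_selfAdjoint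
    hb_pos hdet hb_pullback)
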